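/- Let $T$ be a polytree, i.e. a finite directed acyclic graph whose underlying undirected graph is a tree, with vertex set $V$. A path may traverse edges in either direction; a collider on a path is an interior vertex $k$ entered by both path edges at $k$ ($\cdots\to k\leftarrow\cdots$). A trek from $i$ to $j$ is a simple path from $i$ to $j$ without colliders (the empty path if $i=j$); its top $\mathrm{top}(P)$ is its unique vertex into which no edge of $P$ points, and its $i$-side (resp. $j$-side) is the part between $i$ (resp. $j$) and the top, top included. Let $\Sigma=(\sigma_{ij})$ be the symmetric $V\times V$ matrix of indeterminates, $\mathbb{C}[\Sigma]$ the polynomial ring in its entries (with $\sigma_{ij}=\sigma_{ji}$), and let $I_T$ be the kernel of the $\mathbb{C}$-algebra homomorphism $$\phi_T:\mathbb{C}[\Sigma]\to\mathbb{C}[a_i,\lambda_{kl}\mid i\in V,\ k\to l\in E(T)],\qquad \sigma_{ij}\mapsto\sum_{P \text{ trek from } i \text{ to } j} a_{\mathrm{top}(P)}\prod_{k\to l\in P}\lambda_{kl}.$$ For disjoint $A,B,C\subseteq V$, the set $C$ d-separates $A$ from $B$ if every simple path from a vertex of $A$ to a vertex of $B$ contains a non-collider belonging to $C$, or a collider that is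 not in $C$ and has no descendant in $C$. Let $C_T\subseteq\mathbb{C}[\Sigma]$ be the conditional independence ideal, generated by all $(\#C+1)$-minors of $\Sigma_{A\cup C,\,B\cup C}$ over all disjoint $A,B,C$ such that $C$ d-separates $A$ from $B$. A vertex $c$ is a choke point between $I,J\subseteq V$ if every trek from a vertex of $I$ to a vertex of $J$ contains $c$, and $c$ lies on the $I$-side of all these treks or on the $J$-side of all these treks. Then $I_T=C_T$. Moreover, $I_T$ is generated by the linear forms $\sigma_{ij}$ for the pairs $i,j$ with no trek between them, together with the tetrads $\sigma_{ij}\sigma_{kl}-\sigma_{il}\sigma_{jk}$ for those $i,j,k,l\in V$ (not necessarily distinct) such that there is a choke point between $\{i,k\}$ and $\{j,l\}$. -/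

import Mathlib

noncomputable section

/-- A directed acyclic graph: a digraph without directed cycles (in particular without loops). -/
structure DAG (V : Type*) extends Digraph V where
  acyclic : ∀ v, ¬ Relation.TransGen Adj v v

namespace DAG

variable {V : Type*}

/-- The underlying undirected graph. -/
def skeleton (G : DAG V) : SimpleGraph V := G.toDigraph.toSimpleGraphInclusive

/-- A polytree: a DAG whose underlying undirected graph is a tree. -/
def IsPolytree (G : DAG V) : Prop := G.skeleton.IsTree

/-- `w` is a (proper) descendant of `v`: there is a directed path from `v` to `w`. -/
def IsDescendant (G : DAG V) (v w : V) : Prop := Relation.TransGen G.Adj v w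

/-- `v` is a collider on the walk `p`: `p` runs `… u → v ← w …`. -/
def IsCollider (G : DAG V) {i j : V} (p : G.skeleton.Walk i j) (v : V) : Prop :=
  ∃ u w, [u, v, w] <:+: p.support ∧ G.Adj u v ∧ G.Adj w v

/-- The set `T(i,j)` of treks: simple paths from `i` to `j` in `G` (edges may be traversed in
either direction) without colliders. -/
def Trek (G : DAG V) (i j : V) : Type _ :=
  {p : G.skeleton.Walk i j // p.IsPath ∧ ∀ v, ¬ G.IsCollider p v}

/-- `t` lies on the walk `p` and no directed edge of `p` points into `t`. -/
def IsTop (G : DAG V) {i j : V} (p : G.skeleton.Walk i j) (t : V) : Prop :=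
  t ∈ p.support ∧ ∀ u, s(u, t) ∈ p.edges → ¬ G.Adj u t

/-- The directed edges of `G`. -/
abbrev Edge (G : DAG V) : Type _ := {e : V × V // G.Adj e.1 e.2}

/-- The parameter ring `ℂ[a_i, λ_ij]`; `a_i` is `X (inl i)` and `λ_ij` is `X (inr (i,j))`. -/
abbrev ParamRing (G : DAG V) : Type _ := MvPolynomial (V ⊕ G.Edge) ℂ

theorem isCollider_reverse (G : DAG V) {i j : V} (p : G.skeleton.Walk i j) (v : V)
    (h : G.IsCollider p.reverse v) : G.IsCollider p v := by
  obtain ⟨u, w, h1, h2, h3⟩ := h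
  refine ⟨w, u, ?_, h3, h2⟩
  rw [SimpleGraph.Walk.support_reverse] at h1
  simpa using List.reverse_infix.2 h1

/-- Traversing a trek backwards. -/
def Trek.reverse {G : DAG V} {i j : V} (P : G.Trek i j) : G.Trek j i :=
  ⟨P.1.reverse, P.2.1.reverse, fun v h => P.2.2 v (G.isCollider_reverse P.1 v h)⟩

theorem Trek.reverse_reverse {G : DAG V} {i j : V} (P : G.Trek i j) : P.reverse.reverse = P :=
  Subtype.ext P.1.reverse_reverse

/-- The polynomial ring `ℂ[Σ] = ℂ[σ_ij]` in the entries of a symmetric matrix: one variable for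
each unordered pair of (not necessarily distinct) vertices. -/
abbrev CovRing (V : Type*) : Type _ := MvPolynomial (Sym2 V) ℂ

/-- The variable `σ_ij = σ_ji`. -/
def σ (i j : V) : CovRing V := MvPolynomial.X s(i, j)

/-- `C` d-separates `A` from `B`: every path from `A` to `B` contains a non-collider in `C`, or a
collider that is not in `C` and has no descendant in `C`. -/
def DSeparates (G : DAG V) (C A B : Finset V) : Prop :=
  ∀ i ∈ A, ∀ j ∈ B, ∀ p : G.skeleton.Walk i j, p.IsPath →
    ∃ k ∈ p.support,
      (¬ G.IsCollider p k ∧ k ∈ C) ∨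
      (G.IsCollider p k ∧ k ∉ C ∧ ∀ d ∈ C, ¬ G.IsDescendant k d)

/-- The symmetric matrix `Σ` of indeterminates. -/
def covMatrix (V : Type*) : Matrix V V (CovRing V) := Matrix.of σ

variable [Fintype V]

theorem exists_isTop (G : DAG V) {i j : V} (p : G.skeleton.Walk i j) : ∃ t, G.IsTop p t := by
  have : Std.Irrefl (Relation.TransGen G.Adj) := ⟨G.acyclic⟩
  have wf : WellFounded (Relation.TransGen G.Adj) := Finite.wellFounded_of_trans_of_irrefl _
  obtain ⟨t, ht, hmin⟩ := wf.has_min {v | v ∈ p.support} ⟨i, p.start_mem_support⟩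
  exact ⟨t, ht, fun u hu h => hmin u (p.fst_mem_support_of_mem_edges hu) (.single h)⟩

instance finiteTrek (G : DAG V) (i j : V) : Finite (G.Trek i j) := by
  classical
  exact Finite.of_injective (β := G.skeleton.Path i j) (fun P => ⟨P.1, P.2.1⟩)
    fun P Q h => Subtype.ext (congrArg (fun R : G.skeleton.Path i j => R.1) h)

instance fintypeTrek (G : DAG V) (i j : V) : Fintype (G.Trek i j) := Fintype.ofFinite _

/-- The topmost vertex `top(P)` of a trek `P`: its only vertex into which no edge of `P` points. -/
def Trek.top {G : DAG V} {i j : V} (P : G.Trek i j) : V := (G.exists_isTop P.1).choose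

theorem Trek.top_mem {G : DAG V} {i j : V} (P : G.Trek i j) : P.top ∈ P.1.support :=
  (G.exists_isTop P.1).choose_spec.1

open scoped Classical in
/-- The monomial `a_top(P) * ∏_{k → l ∈ P} λ_kl` of a trek `P`. -/
def Trek.monomial {G : DAG V} {i j : V} (P : G.Trek i j) : G.ParamRing :=
  MvPolynomial.X (Sum.inl P.top) *
    ∏ e : G.Edge with s(e.1.1, e.1.2) ∈ P.1.edges, MvPolynomial.X (Sum.inr e)

/-- The polynomial `σ_ij(a, λ)` of the trek rule. -/
def trekPolynomial (G : DAG V) (i j : V) : G.ParamRing := ∑ P : G.Trek i j, P.monomial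

theorem Trek.monomial_reverse {G : DAG V} {i j : V} (P : G.Trek i j) :
    P.reverse.monomial = P.monomial := by
  classical
  have hT : G.IsTop P.1.reverse = G.IsTop P.1 := by
    funext t; simp [IsTop]
  have ht : P.reverse.top = P.top := by
    unfold Trek.top Trek.reverse
    congr 1
  unfold Trek.monomial
  rw [ht]
  congr 1
  refine Finset.prod_congr (Finset.ext fun e => ?_) fun _ _ => rfl
  simp only [Finset.mem_filter_univ]
  simp [Trek.reverse]

theorem trekPolynomial_comm (G : DAG V) (i j : V) :
    G.trekPolynomial i j = G.trekPolynomial j i :=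
  Fintype.sum_equiv
    ⟨Trek.reverse, Trek.reverse, Trek.reverse_reverse, Trek.reverse_reverse⟩ _ _
    fun P => P.monomial_reverse.symm

/-- The ring homomorphism `φ_G : ℂ[Σ] → ℂ[a, λ]`, `σ_ij ↦ σ_ij(a, λ)`. -/
def φ (G : DAG V) : CovRing V →ₐ[ℂ] G.ParamRing :=
  MvPolynomial.aeval (Sym2.lift ⟨G.trekPolynomial, G.trekPolynomial_comm⟩)

/-- The vanishing ideal `I_G = ker φ_G`. -/
def vanishingIdeal (G : DAG V) : Ideal (CovRing V) := RingHom.ker G.φ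

/-- The conditional independence ideal `C_G`, generated by all `(#C+1)`-minors of
`Σ_{A ∪ C, B ∪ C}` for disjoint `A`, `B`, `C` such that `C` d-separates `A` from `B`. A minor is
given by a choice of `#C+1` distinct rows and columns. -/
def ciIdeal (G : DAG V) : Ideal (CovRing V) :=
  Ideal.span {f | ∃ A B C : Finset V, Disjoint A B ∧ Disjoint A C ∧ Disjoint B C ∧
    G.DSeparates C A B ∧
    ∃ r c : Fin (C.card + 1) ↪ V, (∀ k, r k ∈ A ∨ r k ∈ C) ∧ (∀ k, c k ∈ B ∨ c k ∈ C) ∧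
      f = ((covMatrix V).submatrix r c).det}

open scoped Classical in
/-- `c` is on the `i`-side of the trek `P` from `i` to `j`: between `i` and the top, inclusive. -/
def Trek.OnLeft {G : DAG V} {i j : V} (P : G.Trek i j) (c : V) : Prop :=
  c ∈ (P.1.takeUntil P.top P.top_mem).support

open scoped Classical in
/-- `c` is on the `j`-side of the trek `P` from `i` to `j`: between the top and `j`, inclusive. -/
def Trek.OnRight {G : DAG V} {i j : V} (P : G.Trek i j) (c : V) : Prop :=
  c ∈ (P.1.dropUntil P.top P.top_mem).support

/-- `c` is a choke point between `I` and `J`: every trek from `I` to `J` contains `c`, and `c` is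
on the `I`-side of all of them or on the `J`-side of all of them. -/
def IsChokePoint (G : DAG V) (c : V) (I J : Set V) : Prop :=
  (∀ i ∈ I, ∀ j ∈ J, ∀ P : G.Trek i j, c ∈ P.1.support) ∧
  ((∀ i ∈ I, ∀ j ∈ J, ∀ P : G.Trek i j, P.OnLeft c) ∨
   (∀ i ∈ I, ∀ j ∈ J, ∀ P : G.Trek i j, P.OnRight c))

/-- The linear forms `σ_ij` for the pairs `i, j` without a trek. -/
def linearForms (G : DAG V) : Set (CovRing V) := {f | ∃ i j, IsEmpty (G.Trek i j) ∧ f = σ i j}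

/-- The tetrads `σ_ij σ_kl - σ_il σ_jk` for which there is a choke point between `{i, k}` and
`{j, l}`. -/
def tetrads (G : DAG V) : Set (CovRing V) :=
  {f | ∃ i j k l, (∃ c, G.IsChokePoint c {i, k} {j, l}) ∧ f = σ i j * σ k l - σ i l * σ j k}

end DAG

end

/-! In a tree two vertices are joined by one path, hence by at most one trek, so φ sends each σ_ij
to 0 or to a single monomial. The theorem follows from the cycle of inclusions span ⊆ C_T ⊆ I_T ⊆
span, where span is the ideal of the linear forms and tetrads.

I_T ⊆ span (`vanishingIdeal_le_span`): modulo the linear forms it suffices to connect any two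
products of trek variables with the same image. The exponent vector of the image records, at every
vertex v, how many treks pass through v, end there, use a given edge at v, or have top v. Comparing
these numbers shows that a trek of one product can be rebuilt inside the other, one edge at a time,
by exchanging tails of treks at a common vertex (`AllTreks.exists_exchange`). Each exchange is a
tetrad with that vertex as choke point (`exchange_mem_span`). Cancelling the rebuilt trek gives an
induction (`AllTreks.sub_mem_span`).

span ⊆ C_T (`span_le_ciIdeal`): if all four treks of a tetrad exist, the choke point alone
d-separates rows from columns. Otherwise both products of the tetrad contain a linear form.

C_T ⊆ I_T (`ciIdeal_le_vanishingIdeal`): passing from the variances a_i to error variances, φ(σ_ij)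
becomes a sum over common ancestors t of pairs of directed paths from t to i and to j
(`trekPolynomial_eq_sum_errorVariance`). A d-separating C splits into two parts, one blocking the
first path or the other the second (`DSeparates.exists_btw`). Cutting the paths there factors the
block of covariances through #C indices, so its (#C+1)-minors vanish. -/

noncomputable section

/-! ### Betweenness and directions in a tree. -/

namespace SimpleGraph.IsTree

variable {V : Type*} {G : SimpleGraph V}

/-- The unique path between two vertices of a tree. -/
def path (hG : G.IsTree) (i j : V) : G.Walk i j := (hG.existsUnique_path i j).choose

/-- The vertex `u` lies on the path between `i` and `j`. -/
def Btw (hG : G.IsTree) (u i j : V) : Prop := u ∈ (hG.path i j).support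

/-- The first vertex after `u` on the path from `u` to `i`; it is `u` itself if `i = u`. -/
def next (hG : G.IsTree) (u i : V) : V := (hG.path u i).snd

variable (hG : G.IsTree)
include hG

theorem path_isPath (i j : V) : (hG.path i j).IsPath := (hG.existsUnique_path i j).choose_spec.1

theorem eq_path {i j : V} {p : G.Walk i j} (hp : p.IsPath) : p = hG.path i j :=
  (hG.existsUnique_path i j).choose_spec.2 p hp

theorem reverse_path (i j : V) : (hG.path i j).reverse = hG.path j i :=
  hG.eq_path (hG.path_isPath i j).reverse

theorem path_self (i : V) : hG.path i i = .nil := (hG.eq_path (Walk.IsPath.nil)).symm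

theorem btw_comm {u i j : V} : hG.Btw u i j ↔ hG.Btw u j i := by
  unfold Btw
  rw [← hG.reverse_path j i, Walk.support_reverse, List.mem_reverse]

theorem btw_left (i j : V) : hG.Btw i i j := Walk.start_mem_support _

theorem btw_right (i j : V) : hG.Btw j i j := Walk.end_mem_support _

theorem btw_self {u i : V} : hG.Btw u i i ↔ u = i := by
  unfold Btw
  rw [path_self]
  simp

theorem next_self (i : V) : hG.next i i = i := by
  unfold next
  rw [path_self]
  rfl

theorem not_nil_path {i j : V} (h : i ≠ j) : ¬ (hG.path i j).Nil := Walk.not_nil_of_ne h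

theorem adj_next {u i : V} (h : u ≠ i) : G.Adj u (hG.next u i) :=
  Walk.adj_snd (hG.not_nil_path h)

theorem next_eq_self {u i : V} : hG.next u i = u ↔ u = i := by
  constructor
  · intro h
    by_contra hne
    exact (hG.adj_next hne).ne h.symm
  · rintro rfl
    exact hG.next_self u

theorem btw_next (u i : V) : hG.Btw (hG.next u i) u i := Walk.getVert_mem_support _ _

theorem takeUntil_path [DecidableEq V] {u i j : V} (h : u ∈ (hG.path i j).support) :
    (hG.path i j).takeUntil u h = hG.path i u := hG.eq_path ((hG.path_isPath i j).takeUntil h)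

theorem dropUntil_path [DecidableEq V] {u i j : V} (h : u ∈ (hG.path i j).support) :
    (hG.path i j).dropUntil u h = hG.path u j := hG.eq_path ((hG.path_isPath i j).dropUntil h)

theorem path_append {u i j : V} (h : hG.Btw u i j) :
    (hG.path i u).append (hG.path u j) = hG.path i j := by
  classical
  have h' : u ∈ (hG.path i j).support := h
  rw [← hG.takeUntil_path h', ← hG.dropUntil_path h', Walk.take_spec]

theorem next_eq_of_btw {u v j : V} (h : hG.Btw v u j) (huv : u ≠ v) :
    hG.next u j = hG.next u v := by
  classical
  have h' : v ∈ (hG.path u j).support := h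
  unfold next
  rw [← hG.takeUntil_path h', Walk.snd_takeUntil huv.symm]

theorem path_tail (i j : V) : (hG.path i j).tail = hG.path (hG.next i j) j :=
  hG.eq_path (hG.path_isPath i j).tail

theorem length_path {i j : V} (h : i ≠ j) :
    (hG.path i j).length = (hG.path (hG.next i j) j).length + 1 := by
  rw [← Walk.length_tail_add_one (hG.not_nil_path h)]
  exact congrArg (fun p : G.Walk (hG.next i j) j => p.length + 1) (hG.path_tail i j)

/-- Two paths leaving `v` by different edges meet only in `v`, so they join to a path; leaving by
the same edge, they would repeat its other end. Betweenness thus becomes a comparison of directions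
at `v`, the value `v` marking an empty path. -/
theorem btw_iff {v i j : V} : hG.Btw v i j ↔ (hG.next v i = hG.next v j → hG.next v i = v) := by
  constructor
  · intro h heq
    by_contra hne
    have hvi : v ≠ i := fun h' => hne (hG.next_eq_self.2 h')
    have h1 : hG.next v i ∈ (hG.path i v).support := hG.btw_comm.1 (hG.btw_next v i)
    have h2 : hG.next v i ∈ (hG.path v j).support := by rw [heq]; exact hG.btw_next v j
    have hp := hG.path_isPath i j
    rw [← hG.path_append h] at hp
    exact Walk.IsPath.ne_of_mem_support_of_append hp hne h1 h2 rfl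
  · intro h
    by_cases hi : v = i
    · subst hi; exact hG.btw_left _ _
    have hne : hG.next v i ≠ hG.next v j := fun h' => hi (hG.next_eq_self.1 (h h'))
    have : ((hG.path i v).append (hG.path v j)).IsPath := by
      rw [Walk.isPath_def, Walk.support_append, List.nodup_append']
      refine ⟨(hG.path_isPath _ _).support_nodup, (hG.path_isPath _ _).support_nodup.tail, ?_⟩
      intro x hx hx'
      have hxv : v ≠ x := by
        rintro rfl
        have := (hG.path_isPath v j).support_nodup
        rw [← Walk.cons_tail_support] at this
        exact (List.nodup_cons.1 this).1 hx'
      refine hne ?_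
      rw [hG.next_eq_of_btw (hG.btw_comm.1 hx) hxv,
        hG.next_eq_of_btw (List.mem_of_mem_tail hx' : hG.Btw x v j) hxv]
    unfold Btw
    rw [← hG.eq_path this]
    simp

theorem not_btw_iff {v i j : V} :
    ¬ hG.Btw v i j ↔ hG.next v i = hG.next v j ∧ v ≠ i ∧ v ≠ j := by
  rw [btw_iff, ← not_iff_not]
  have h1 : hG.next v i = v ↔ v = i := hG.next_eq_self
  have h2 : hG.next v j = v ↔ v = j := hG.next_eq_self
  grind

/-- The branch of the tree at `u` that contains `c` cannot contain both `i` and `j`. -/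
theorem btw_or {u i j : V} (h : hG.Btw u i j) (c : V) : hG.Btw u i c ∨ hG.Btw u c j := by
  simp only [btw_iff] at *
  grind

theorem btw_of_btw_left {u v i l : V} (hu : hG.Btw u i v) (hv : hG.Btw v i l) : hG.Btw v u l := by
  by_cases h : v = u
  · subst h; exact hG.btw_left _ _
  rw [btw_iff] at hv ⊢
  rwa [← hG.next_eq_of_btw (hG.btw_comm.1 hu) h]

theorem btw_trans_left {u v i l : V} (hu : hG.Btw u i v) (hv : hG.Btw v i l) : hG.Btw u i l := by
  unfold Btw
  rw [← hG.path_append hv, Walk.mem_support_append_iff]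
  exact .inl hu

theorem btw_trans_right {u v i l : V} (hu : hG.Btw u v l) (hv : hG.Btw v i l) : hG.Btw u i l :=
  hG.btw_comm.1 (hG.btw_trans_left (hG.btw_comm.1 hu) (hG.btw_comm.1 hv))

theorem btw_of_btw_right {u v i l : V} (hu : hG.Btw u v l) (hv : hG.Btw v i l) : hG.Btw v i u :=
  hG.btw_comm.1 (hG.btw_of_btw_left (hG.btw_comm.1 hu) (hG.btw_comm.1 hv))

theorem btw_antisymm {u v i : V} (h : hG.Btw u i v) (h' : hG.Btw v i u) : u = v := by
  have := hG.btw_of_btw_left h h'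
  exact (hG.btw_self.1 this).symm

theorem next_next {i j : V} (h : i ≠ j) : hG.next (hG.next i j) i = i := by
  have hne : hG.next i j ≠ i := fun h' => h (hG.next_eq_self.1 h')
  have hp : (Walk.cons (hG.adj_next h).symm Walk.nil).IsPath := by simpa using hne
  show (hG.path (hG.next i j) i).snd = i
  rw [← hG.eq_path hp]
  rfl

theorem next_of_adj {u w : V} (h : G.Adj u w) : hG.next u w = w := by
  have hp : (Walk.cons h Walk.nil).IsPath := by simpa using h.ne
  show (hG.path u w).snd = w
  rw [← hG.eq_path hp]
  rfl

/-- Every three vertices of a tree have a median. -/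
theorem exists_median (a b c : V) : ∃ m, hG.Btw m a b ∧ hG.Btw m a c ∧ hG.Btw m b c := by
  induction hn : (hG.path c a).length generalizing c with
  | zero =>
    have : c = a := Walk.eq_of_length_eq_zero hn
    subst this
    exact ⟨c, hG.btw_left _ _, hG.btw_left _ _, hG.btw_right _ _⟩
  | succ n ih =>
    by_cases h : hG.Btw c a b
    · exact ⟨c, h, hG.btw_right _ _, hG.btw_right _ _⟩
    -- Off the path, `c` sees `a` and `b` in the same direction; a step that way changes no median.
    obtain ⟨h1, h2, h3⟩ := hG.not_btw_iff.1 h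
    rw [hG.length_path h2] at hn
    obtain ⟨m, hm1, hm2, hm3⟩ := ih (hG.next c a) (by omega)
    refine ⟨m, hm1, hG.btw_trans_left hm2 (hG.btw_comm.1 (hG.btw_next c a)),
      hG.btw_trans_left hm3 ?_⟩
    rw [h1]
    exact hG.btw_comm.1 (hG.btw_next c b)

theorem mem_edges_path {v w i j : V} :
    s(v, w) ∈ (hG.path i j).edges ↔
      hG.Btw v i j ∧ w ≠ v ∧ (w = hG.next v i ∨ w = hG.next v j) := by
  constructor
  · intro h
    have hv : hG.Btw v i j := Walk.fst_mem_support_of_mem_edges _ h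
    refine ⟨hv, (Walk.adj_of_mem_edges _ h).ne.symm, ?_⟩
    rw [← hG.path_append hv, Walk.edges_append, List.mem_append] at h
    rcases h with h | h
    · left
      rw [← hG.reverse_path v i, Walk.edges_reverse, List.mem_reverse] at h
      exact (hG.path_isPath v i).eq_snd_of_mem_edges h
    · right
      exact (hG.path_isPath v j).eq_snd_of_mem_edges h
  · rintro ⟨hv, hne, h⟩
    rw [← hG.path_append hv, Walk.edges_append, List.mem_append]
    rcases h with rfl | rfl
    · left
      rw [← hG.reverse_path v i, Walk.edges_reverse, List.mem_reverse]
      exact Walk.mk_start_snd_mem_edges (hG.not_nil_path fun h => hne (hG.next_eq_self.2 h))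
    · right
      exact Walk.mk_start_snd_mem_edges (hG.not_nil_path fun h => hne (hG.next_eq_self.2 h))

theorem support_path_eq {i j : V} (h : i ≠ j) :
    (hG.path i j).support = i :: (hG.path (hG.next i j) j).support := by
  rw [← Walk.cons_support_tail (hG.not_nil_path h)]
  exact congrArg (fun p : G.Walk (hG.next i j) j => i :: p.support) (hG.path_tail i j)

theorem infix_support_path {v i j : V} (hv : hG.Btw v i j) (hi : v ≠ i) (hj : v ≠ j) :
    [hG.next v i, v, hG.next v j] <:+: (hG.path i j).support := by
  rw [← hG.path_append hv, Walk.support_append, ← hG.reverse_path v i, Walk.support_reverse,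
    hG.support_path_eq hi, hG.support_path_eq hj, ← Walk.cons_tail_support (hG.path _ i),
    ← Walk.cons_tail_support (hG.path _ j)]
  exact ⟨((hG.path (hG.next v i) i).support.tail).reverse,
    (hG.path (hG.next v j) j).support.tail, by
      simp only [List.reverse_cons, List.append_assoc, List.cons_append, List.nil_append,
        List.tail_cons]⟩

/-- The order of `u` and `w` is left open, since being a collider is symmetric in them. -/
theorem next_eq_of_infix_support_path {u v w i j : V}
    (h : [u, v, w] <:+: (hG.path i j).support) :
    hG.Btw v i j ∧ (u = hG.next v i ∧ w = hG.next v j ∨ u = hG.next v j ∧ w = hG.next v i) := by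
  have h1 : s(u, v) ∈ (hG.path i j).edges := Walk.infix_support_iff_mem_edges.1 <| .inl <|
    List.IsInfix.trans ⟨[], [w], by simp⟩ h
  have h2 : s(v, w) ∈ (hG.path i j).edges := Walk.infix_support_iff_mem_edges.1 <| .inl <|
    List.IsInfix.trans ⟨[u], [], by simp⟩ h
  have hne : u ≠ w := by
    have := h.sublist.nodup (hG.path_isPath i j).support_nodup
    grind
  rw [Sym2.eq_swap, mem_edges_path] at h1
  rw [mem_edges_path] at h2
  grind

end SimpleGraph.IsTree

/-! ### Treks and their tops as local conditions along tree paths. -/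

namespace DAG

variable {V : Type*} {T : DAG V}

theorem not_adj_self (v : V) : ¬ T.Adj v v := fun h => T.acyclic v (.single h)

theorem not_adj_symm {u v : V} (h : T.Adj u v) : ¬ T.Adj v u := fun h' =>
  T.acyclic v (.tail (.single h') h)

theorem skeleton_adj {u v : V} : T.skeleton.Adj u v ↔ T.Adj u v ∨ T.Adj v u := by
  have : ∀ {u v}, T.Adj u v → u ≠ v := by
    rintro u v h rfl
    exact T.not_adj_self u h
  simp only [skeleton, Digraph.toSimpleGraphInclusive, SimpleGraph.fromRel_adj]
  constructor
  · exact fun h => h.2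
  · rintro (h | h)
    · exact ⟨this h, .inl h⟩
    · exact ⟨(this h).symm, .inr h⟩

variable (hG : T.skeleton.IsTree)

/-- The path between `i` and `j` has no collider, so that it is a trek. -/
def IsTrekPair (i j : V) : Prop :=
  ∀ u, hG.Btw u i j → ¬ (T.Adj (hG.next u i) u ∧ T.Adj (hG.next u j) u)

/-- `t` is the top of the path between `i` and `j`. -/
def IsTopOf (t i j : V) : Prop :=
  hG.Btw t i j ∧ ¬ T.Adj (hG.next t i) t ∧ ¬ T.Adj (hG.next t j) t

theorem isCollider_path {i j v : V} : T.IsCollider (hG.path i j) v ↔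
    hG.Btw v i j ∧ T.Adj (hG.next v i) v ∧ T.Adj (hG.next v j) v := by
  constructor
  · rintro ⟨u, w, h, hu, hw⟩
    obtain ⟨hb, ⟨rfl, rfl⟩ | ⟨rfl, rfl⟩⟩ := hG.next_eq_of_infix_support_path h
    · exact ⟨hb, hu, hw⟩
    · exact ⟨hb, hw, hu⟩
  · rintro ⟨hb, hu, hw⟩
    refine ⟨_, _, hG.infix_support_path hb ?_ ?_, hu, hw⟩
    · rintro rfl
      rw [hG.next_self] at hu
      exact T.not_adj_self _ hu
    · rintro rfl
      rw [hG.next_self] at hw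
      exact T.not_adj_self _ hw

theorem Trek.val_eq_path {i j : V} (P : T.Trek i j) : P.1 = hG.path i j := hG.eq_path P.2.1

theorem nonempty_trek_iff {i j : V} : Nonempty (T.Trek i j) ↔ T.IsTrekPair hG i j := by
  constructor
  · rintro ⟨P⟩ u hb h
    have := P.2.2 u
    rw [P.val_eq_path hG, isCollider_path] at this
    exact this ⟨hb, h⟩
  · intro h
    exact ⟨⟨hG.path i j, hG.path_isPath i j, fun v hv =>
      h v ((isCollider_path hG).1 hv).1 ((isCollider_path hG).1 hv).2⟩⟩

variable {hG}

theorem Trek.isTrekPair {i j : V} (P : T.Trek i j) : T.IsTrekPair hG i j :=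
  (nonempty_trek_iff hG).1 ⟨P⟩

theorem IsTrekPair.symm {i j : V} (h : T.IsTrekPair hG i j) : T.IsTrekPair hG j i :=
  fun u hu hc => h u (hG.btw_comm.1 hu) ⟨hc.2, hc.1⟩

theorem isTrekPair_self (i : V) : T.IsTrekPair hG i i := by
  intro u hu h
  rw [hG.btw_self] at hu
  subst hu
  rw [hG.next_self] at h
  exact T.not_adj_self _ h.1

/-- Because `next u u = u` and there are no loops, "an edge enters `u` from that side" is false at
an end of a path. This is why `IsTrekPair` and `IsTopOf` need no exception for ends. -/
theorem next_ne_of_adj {u i : V} (h : T.Adj (hG.next u i) u) : u ≠ i := by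
  rintro rfl
  rw [hG.next_self] at h
  exact T.not_adj_self _ h

theorem adj_next_of_not {u i : V} (h : ¬ T.Adj (hG.next u i) u) (hne : u ≠ i) :
    T.Adj u (hG.next u i) := (skeleton_adj.1 (hG.adj_next hne)).resolve_right h

theorem IsTrekPair.of_btw {u i j : V} (h : T.IsTrekPair hG i j) (hu : hG.Btw u i j) :
    T.IsTrekPair hG i u := by
  intro v hv hc
  have hne : v ≠ u := next_ne_of_adj hc.2
  refine h v (hG.btw_trans_left hv hu) ⟨hc.1, ?_⟩
  rw [hG.next_eq_of_btw (hG.btw_of_btw_left hv hu) hne]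
  exact hc.2

/-- A trek that starts downwards keeps going downwards. -/
theorem IsTrekPair.not_adj_next {a b u : V} (h : T.IsTrekPair hG a b)
    (ha : ¬ T.Adj (hG.next a b) a) (hu : hG.Btw u a b) : ¬ T.Adj (hG.next u b) u := by
  induction hn : (hG.path u a).length generalizing u with
  | zero =>
    have : u = a := SimpleGraph.Walk.eq_of_length_eq_zero hn
    subst this
    exact ha
  | succ n ih =>
    have hne : u ≠ a := by
      rintro rfl
      rw [hG.path_self] at hn
      simp at hn
    rw [hG.length_path hne] at hn
    have hb1 : hG.Btw (hG.next u a) a u := hG.btw_comm.1 (hG.btw_next u a)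
    have h1 := ih (hG.btw_trans_left hb1 hu) (by omega)
    have hb2 : hG.Btw u (hG.next u a) b := hG.btw_of_btw_left hb1 hu
    have hne' : hG.next u a ≠ u := fun h' => hne (hG.next_eq_self.1 h')
    rw [hG.next_eq_of_btw hb2 hne', hG.next_next hne] at h1
    have h2 : T.Adj (hG.next u a) u := (skeleton_adj.1 (hG.adj_next hne)).resolve_left h1
    exact fun h3 => h u hu ⟨h2, h3⟩

/-- A trek that starts downwards arrives along an edge pointing to its end. -/
theorem IsTrekPair.adj_next_right {a b : V} (h : T.IsTrekPair hG a b)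
    (ha : ¬ T.Adj (hG.next a b) a) (hne : a ≠ b) : T.Adj (hG.next b a) b := by
  have hb1 : hG.Btw (hG.next b a) a b := hG.btw_comm.1 (hG.btw_next b a)
  have h1 := h.not_adj_next ha hb1
  rw [hG.next_next hne.symm] at h1
  exact (skeleton_adj.1 (hG.adj_next hne.symm)).resolve_left h1

theorem IsTopOf.symm {t i j : V} (h : T.IsTopOf hG t i j) : T.IsTopOf hG t j i :=
  ⟨hG.btw_comm.1 h.1, h.2.2, h.2.1⟩

/-- Between two distinct tops the trek would leave one downwards and so arrive at the other along an
edge pointing into it. -/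
theorem IsTopOf.eq {t t' i j : V} (hij : T.IsTrekPair hG i j) (h : T.IsTopOf hG t i j)
    (h' : T.IsTopOf hG t' i j) : t = t' := by
  have key : ∀ {t t'}, T.IsTopOf hG t i j → T.IsTopOf hG t' i j → hG.Btw t i t' → t = t' := by
    intro t t' h h' hb
    by_contra hne
    have hb' : hG.Btw t' t j := hG.btw_of_btw_left hb h'.1
    have h1 : T.IsTrekPair hG t t' :=
      IsTrekPair.of_btw (hij.symm.of_btw (hG.btw_comm.1 h.1)).symm hb'
    have h2 := h.2.2
    rw [hG.next_eq_of_btw hb' hne] at h2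
    have h3 := h1.adj_next_right h2 hne
    rw [← hG.next_eq_of_btw (hG.btw_comm.1 hb) (Ne.symm hne)] at h3
    exact h'.2.1 h3
  rcases hG.btw_or h.1 t' with hb | hb
  · exact key h h' hb
  · exact (key h' h (hG.btw_of_btw_right hb h'.1)).symm

variable (hG) in
theorem isTop_path {t i j : V} : T.IsTop (hG.path i j) t ↔ T.IsTopOf hG t i j := by
  constructor
  · rintro ⟨h1, h2⟩
    refine ⟨h1, fun h3 => ?_, fun h3 => ?_⟩ <;>
    · refine h2 _ ?_ h3
      rw [Sym2.eq_swap, hG.mem_edges_path]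
      refine ⟨h1, ?_, by simp⟩
      rintro h
      rw [h] at h3
      exact T.not_adj_self _ h3
  · rintro ⟨h1, h2, h3⟩
    refine ⟨h1, fun u hu => ?_⟩
    rw [Sym2.eq_swap, hG.mem_edges_path] at hu
    rcases hu.2.2 with rfl | rfl
    · exact h2
    · exact h3

/-- The exchange of tails at a vertex `v` of two treks. -/
theorem IsTrekPair.exchange {i j k l v : V} (hij : T.IsTrekPair hG i j)
    (hkl : T.IsTrekPair hG k l) (h1 : hG.Btw v i j) (h2 : hG.Btw v k l) (h3 : hG.Btw v i l)
    (h4 : ¬ (T.Adj (hG.next v i) v ∧ T.Adj (hG.next v l) v)) : T.IsTrekPair hG i l := by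
  intro u hu hc
  by_cases huv : u = v
  · subst huv
    exact h4 hc
  -- Away from `v`, a collider lies on one of the two halves and is already a collider of the trek
  -- that half comes from.
  rcases hG.btw_or hu v with hb | hb
  · refine hij u (hG.btw_trans_left hb h1) ⟨hc.1, ?_⟩
    rw [hG.next_eq_of_btw (hG.btw_of_btw_left hb h1) huv]
    rw [hG.next_eq_of_btw (hG.btw_of_btw_left hb h3) huv] at hc
    exact hc.2
  · refine hkl u (hG.btw_trans_right hb h2) ⟨?_, hc.2⟩
    rw [hG.next_eq_of_btw (hG.btw_comm.1 (hG.btw_of_btw_right hb h2)) huv]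
    rw [hG.next_eq_of_btw (hG.btw_comm.1 (hG.btw_of_btw_right hb h3)) huv] at hc
    exact hc.1

variable [Fintype V]

theorem Trek.isTopOf_top {i j : V} (P : T.Trek i j) : T.IsTopOf hG P.top i j := by
  have := (T.exists_isTop P.1).choose_spec
  change T.IsTop P.1 P.top at this
  rwa [P.val_eq_path hG, isTop_path] at this

theorem IsTrekPair.exists_isTopOf {i j : V} (h : T.IsTrekPair hG i j) :
    ∃ t, T.IsTopOf hG t i j := by
  obtain ⟨P⟩ := (nonempty_trek_iff hG).2 h
  exact ⟨_, P.isTopOf_top⟩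

-- From the top the trek descends towards `i`, so on the `i`-side the edge towards `i` leaves `c`,
-- while strictly beyond the top it enters `c`. Sides can therefore be tested without naming the
-- top.
variable (hG) in
theorem Trek.onLeft_iff {i j : V} (P : T.Trek i j) {c : V} :
    P.OnLeft c ↔ hG.Btw c i j ∧ ¬ T.Adj (hG.next c i) c := by
  classical
  have hP := P.isTrekPair (hG := hG)
  have ht := P.isTopOf_top (hG := hG)
  have e : P.OnLeft c ↔ hG.Btw c i P.top := by
    unfold Trek.OnLeft SimpleGraph.IsTree.Btw
    rw [hG.eq_path (P.2.1.takeUntil P.top_mem)]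
  rw [e]
  have hdown : T.IsTrekPair hG P.top i := (hP.of_btw ht.1).symm
  constructor
  · intro hc
    exact ⟨hG.btw_trans_left hc ht.1, hdown.not_adj_next ht.2.1 (hG.btw_comm.1 hc)⟩
  · rintro ⟨hc, hn⟩
    rcases hG.btw_or hc P.top with h | h
    · exact h
    by_cases hne : P.top = c
    · rw [hne]
      exact hG.btw_right _ _
    exfalso
    have h1 : T.IsTrekPair hG P.top c :=
      IsTrekPair.of_btw (hP.symm.of_btw (hG.btw_comm.1 ht.1)).symm h
    have h2 := ht.2.2
    rw [hG.next_eq_of_btw h hne] at h2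
    have h3 := h1.adj_next_right h2 hne
    have h4 : hG.Btw P.top c i := hG.btw_comm.1 (hG.btw_of_btw_right h ht.1)
    rw [← hG.next_eq_of_btw h4 (Ne.symm hne)] at h3
    exact hn h3

variable (hG) in
theorem Trek.onRight_iff {i j : V} (P : T.Trek i j) {c : V} :
    P.OnRight c ↔ hG.Btw c i j ∧ ¬ T.Adj (hG.next c j) c := by
  classical
  have e : P.OnRight c ↔ P.reverse.OnLeft c := by
    unfold Trek.OnRight Trek.OnLeft
    rw [hG.eq_path (P.2.1.dropUntil P.top_mem),
      hG.eq_path (P.reverse.2.1.takeUntil P.reverse.top_mem),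
      IsTopOf.eq (hG := hG) P.isTrekPair P.isTopOf_top P.reverse.isTopOf_top.symm]
    exact hG.btw_comm
  rw [e, P.reverse.onLeft_iff hG, hG.btw_comm]

variable (hG) in
theorem isChokePoint_iff {c : V} {I J : Set V} : T.IsChokePoint c I J ↔
    (∀ i ∈ I, ∀ j ∈ J, T.IsTrekPair hG i j → hG.Btw c i j ∧ ¬ T.Adj (hG.next c i) c) ∨
    (∀ i ∈ I, ∀ j ∈ J, T.IsTrekPair hG i j → hG.Btw c i j ∧ ¬ T.Adj (hG.next c j) c) := by
  unfold IsChokePoint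
  simp only [Trek.onLeft_iff hG, Trek.onRight_iff hG, Trek.val_eq_path hG,
    ← nonempty_trek_iff hG]
  constructor
  · rintro ⟨_, h | h⟩
    · exact .inl fun i hi j hj ⟨P⟩ => h i hi j hj P
    · exact .inr fun i hi j hj ⟨P⟩ => h i hi j hj P
  · rintro (h | h)
    · exact ⟨fun i hi j hj P => (h i hi j hj ⟨P⟩).1, .inl fun i hi j hj P => h i hi j hj ⟨P⟩⟩
    · exact ⟨fun i hi j hj P => (h i hi j hj ⟨P⟩).1, .inr fun i hi j hj P => h i hi j hj ⟨P⟩⟩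

end DAG

/-! ### Directed paths, and the vanishing of linear forms and tetrads under φ. -/

namespace DAG

variable {V : Type*} {T : DAG V} {hG : T.skeleton.IsTree}

variable (hG) in
/-- There is a directed path (possibly empty) from `t` to `i`. -/
def Below (t i : V) : Prop := T.IsTrekPair hG t i ∧ ¬ T.Adj (hG.next t i) t

theorem below_self (t : V) : T.Below hG t t :=
  ⟨isTrekPair_self t, by rw [hG.next_self]; exact T.not_adj_self t⟩

theorem Below.not_adj_next {t i u : V} (h : T.Below hG t i) (hu : hG.Btw u t i) :
    ¬ T.Adj (hG.next u i) u := h.1.not_adj_next h.2 hu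

theorem Below.left {t i u : V} (h : T.Below hG t i) (hu : hG.Btw u t i) : T.Below hG t u := by
  refine ⟨h.1.of_btw hu, ?_⟩
  by_cases htu : t = u
  · subst htu
    rw [hG.next_self]
    exact T.not_adj_self t
  rw [← hG.next_eq_of_btw hu htu]
  exact h.2

theorem Below.right {t i u : V} (h : T.Below hG t i) (hu : hG.Btw u t i) : T.Below hG u i :=
  ⟨(h.1.symm.of_btw (hG.btw_comm.1 hu)).symm, h.not_adj_next hu⟩

theorem Below.adj_next {t i : V} (h : T.Below hG t i) (hne : t ≠ i) :
    T.Adj (hG.next i t) i := h.1.adj_next_right h.2 hne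

theorem Below.btw {t m i : V} (h : T.Below hG t m) (h' : T.Below hG m i) : hG.Btw m t i := by
  rw [hG.btw_iff]
  intro heq
  by_contra hne
  have h1 := h.adj_next fun h' => hne (hG.next_eq_self.2 h'.symm)
  rw [heq] at h1
  exact h'.2 h1

theorem Below.trans {t m i : V} (h : T.Below hG t m) (h' : T.Below hG m i) : T.Below hG t i := by
  have hb := h.btw h'
  refine ⟨h.1.exchange h'.1 (hG.btw_right _ _) (hG.btw_left _ _) hb fun hc => h'.2 hc.2, ?_⟩
  by_cases htm : t = m
  · subst htm
    exact h'.2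
  · rw [hG.next_eq_of_btw hb htm]
    exact h.2

theorem below_of_adj {p m : V} (h : T.Adj p m) : T.Below hG p m := by
  have h1 : hG.next p m = m := hG.next_of_adj (skeleton_adj.2 (.inl h))
  have h2 : hG.next m p = p := hG.next_of_adj (skeleton_adj.2 (.inr h))
  refine ⟨fun u hu hc => ?_, by rw [h1]; exact not_adj_symm h⟩
  by_cases hup : u = p
  · subst hup
    rw [hG.next_self] at hc
    exact T.not_adj_self _ hc.1
  by_cases hum : u = m
  · subst hum
    rw [hG.next_self] at hc
    exact T.not_adj_self _ hc.2
  have h4 : hG.next p m = hG.next p u := hG.next_eq_of_btw hu (Ne.symm hup)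
  have h5 : hG.Btw m p u := by
    rw [← h1, h4]
    exact hG.btw_next p u
  exact hum (hG.btw_antisymm hu h5)

/-- Two vertices with a common ancestor are joined by a trek. -/
theorem Below.isTrekPair {t i j : V} (hi : T.Below hG t i) (hj : T.Below hG t j) :
    T.IsTrekPair hG i j := by
  intro u hu hc
  rcases hG.btw_or hu t with h | h
  · exact hi.not_adj_next (hG.btw_comm.1 h) hc.1
  · exact hj.not_adj_next h hc.2

theorem IsTopOf.below {t i j : V} (h : T.IsTopOf hG t i j) (hij : T.IsTrekPair hG i j) :
    T.Below hG t i ∧ T.Below hG t j :=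
  ⟨⟨(hij.of_btw h.1).symm, h.2.1⟩, ⟨(hij.symm.of_btw (hG.btw_comm.1 h.1)).symm, h.2.2⟩⟩

/-- The top of the trek between two vertices lies below every common ancestor. -/
theorem IsTopOf.btw {m t i j : V} (h : T.IsTopOf hG m i j) (hi : T.Below hG t i)
    (hj : T.Below hG t j) : hG.Btw m t i ∧ hG.Btw m t j := by
  -- The median lies on both directed paths from `t`, so no edge of the path between `i` and `j`
  -- enters it: it is the top.
  obtain ⟨n, h1, h2, h3⟩ := hG.exists_median i j t
  rw [hG.btw_comm] at h2 h3
  have : T.IsTopOf hG n i j := ⟨h1, hi.not_adj_next h2, hj.not_adj_next h3⟩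
  rw [IsTopOf.eq (hi.isTrekPair hj) h this]
  exact ⟨h2, h3⟩

/-- If `c` is a choke point on the `I`-side, then the treks can be recombined. -/
theorem isTrekPair_of_choke {c i j k l : V}
    (hc : ∀ a ∈ ({i, k} : Set V), ∀ b ∈ ({j, l} : Set V), T.IsTrekPair hG a b →
      hG.Btw c a b ∧ ¬ T.Adj (hG.next c a) c)
    (hij : T.IsTrekPair hG i j) (hkl : T.IsTrekPair hG k l) : T.IsTrekPair hG i l := by
  obtain ⟨h1, h2⟩ := hc i (by simp) j (by simp) hij
  obtain ⟨h3, h4⟩ := hc k (by simp) l (by simp) hkl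
  by_contra hil
  by_cases hb : hG.Btw c i l
  · exact hil (hij.exchange hkl h1 h3 hb fun h => h2 h.1)
  -- Here `i` and `l` lie in the same direction from `c`, and the edge in that direction leaves `c`;
  -- so `c` is a common ancestor of both.
  · obtain ⟨h5, h6, h7⟩ := hG.not_btw_iff.1 hb
    refine hil (Below.isTrekPair (t := c) ⟨(hij.of_btw h1).symm, h2⟩
      ⟨(hkl.symm.of_btw (hG.btw_comm.1 h3)).symm, ?_⟩)
    rw [← h5]
    exact h2

theorem σ_comm (i j : V) : σ i j = σ j i := by
  unfold σ
  rw [Sym2.eq_swap]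

variable [Fintype V]

open scoped Classical in
variable (hG) in
/-- The product of the edge parameters along the path between `i` and `j`. -/
def weight (i j : V) : T.ParamRing :=
  ∏ e : T.Edge with s(e.1.1, e.1.2) ∈ (hG.path i j).edges, MvPolynomial.X (Sum.inr e)

theorem weight_comm (i j : V) : T.weight hG i j = T.weight hG j i := by
  classical
  unfold weight
  congr 1
  ext e
  rw [← hG.reverse_path i j]
  simp only [Finset.mem_filter_univ, SimpleGraph.Walk.edges_reverse, List.mem_reverse]

theorem weight_self (i : V) : T.weight hG i i = 1 := by
  unfold weight
  simp [hG.path_self]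

theorem weight_mul_weight {c i j : V} (h : hG.Btw c i j) :
    T.weight hG i c * T.weight hG c j = T.weight hG i j := by
  classical
  unfold weight
  have hnd := (hG.path_isPath i j).isTrail.edges_nodup
  rw [← hG.path_append h, SimpleGraph.Walk.edges_append, List.nodup_append'] at hnd
  rw [← Finset.prod_union]
  · congr 1
    ext e
    simp only [Finset.mem_union, Finset.mem_filter_univ]
    rw [← hG.path_append h, SimpleGraph.Walk.edges_append, List.mem_append]
  · rw [Finset.disjoint_left]
    intro e h1 h2
    simp only [Finset.mem_filter_univ] at h1 h2
    exact hnd.2.2 h1 h2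

theorem Trek.monomial_eq {i j : V} (P : T.Trek i j) :
    P.monomial = MvPolynomial.X (Sum.inl P.top) * T.weight hG i j := by
  unfold Trek.monomial weight
  rw [P.val_eq_path hG]

theorem trekPolynomial_eq_zero {i j : V} (h : ¬ T.IsTrekPair hG i j) :
    T.trekPolynomial i j = 0 := by
  rw [← nonempty_trek_iff, not_nonempty_iff] at h
  unfold trekPolynomial
  exact Fintype.sum_empty _

theorem trekPolynomial_eq {i j t : V} (h : T.IsTrekPair hG i j) (ht : T.IsTopOf hG t i j) :
    T.trekPolynomial i j = MvPolynomial.X (Sum.inl t) * T.weight hG i j := by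
  obtain ⟨P⟩ := (nonempty_trek_iff hG).2 h
  have : Subsingleton (T.Trek i j) :=
    ⟨fun P Q => Subtype.ext ((P.val_eq_path hG).trans (Q.val_eq_path hG).symm)⟩
  unfold trekPolynomial
  rw [Fintype.sum_subsingleton _ P, P.monomial_eq (hG := hG), IsTopOf.eq h ht P.isTopOf_top]

theorem φ_σ (i j : V) : T.φ (σ i j) = T.trekPolynomial i j := by
  unfold φ σ
  rw [MvPolynomial.aeval_X]
  rfl

/-- A vertex on the `i`-side of a trek splits off the directed path to `i`. -/
theorem trekPolynomial_eq_weight_mul {c i j : V} (h : T.IsTrekPair hG i j) (hc : hG.Btw c i j)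
    (hn : ¬ T.Adj (hG.next c i) c) :
    T.trekPolynomial i j = T.weight hG c i * T.trekPolynomial c j := by
  have hcj : T.IsTrekPair hG c j := (h.symm.of_btw (hG.btw_comm.1 hc)).symm
  obtain ⟨t, ht⟩ := hcj.exists_isTopOf
  have htc : hG.Btw t i j := hG.btw_trans_right ht.1 hc
  have ht' : T.IsTopOf hG t i j := by
    refine ⟨htc, ?_, ht.2.2⟩
    by_cases htc : t = c
    · subst htc
      exact hn
    · rw [hG.next_eq_of_btw (hG.btw_comm.1 (hG.btw_of_btw_right ht.1 hc)) htc]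
      exact ht.2.1
  rw [trekPolynomial_eq h ht', trekPolynomial_eq hcj ht, ← weight_mul_weight hc, weight_comm i c]
  ring

/-- If all treks exist, the weight of the path from `c` splits off every entry, so the 2×2 block has
rank one. If one product lacks a trek, recombination shows that the other does too. -/
theorem φ_tetrad_of_left {c i j k l : V}
    (hc : ∀ a ∈ ({i, k} : Set V), ∀ b ∈ ({j, l} : Set V), T.IsTrekPair hG a b →
      hG.Btw c a b ∧ ¬ T.Adj (hG.next c a) c) :
    T.φ (σ i j * σ k l - σ i l * σ j k) = 0 := by
  have hc' : ∀ a ∈ ({i, k} : Set V), ∀ b ∈ ({l, j} : Set V), T.IsTrekPair hG a b →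
      hG.Btw c a b ∧ ¬ T.Adj (hG.next c a) c := by
    rw [Set.pair_comm l j]; exact hc
  have hck : ∀ a ∈ ({k, i} : Set V), ∀ b ∈ ({l, j} : Set V), T.IsTrekPair hG a b →
      hG.Btw c a b ∧ ¬ T.Adj (hG.next c a) c := by
    rw [Set.pair_comm l j, Set.pair_comm k i]; exact hc
  have hck' : ∀ a ∈ ({k, i} : Set V), ∀ b ∈ ({j, l} : Set V), T.IsTrekPair hG a b →
      hG.Btw c a b ∧ ¬ T.Adj (hG.next c a) c := by
    rw [Set.pair_comm k i]; exact hc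
  rw [map_sub, map_mul, map_mul]
  simp only [φ_σ]
  rw [T.trekPolynomial_comm j k, sub_eq_zero]
  by_cases h : T.IsTrekPair hG i j ∧ T.IsTrekPair hG k l
  · have hil := isTrekPair_of_choke hc h.1 h.2
    have hkj := isTrekPair_of_choke hck h.2 h.1
    have f : ∀ a ∈ ({i, k} : Set V), ∀ b ∈ ({j, l} : Set V), T.IsTrekPair hG a b →
      T.trekPolynomial a b = T.weight hG c a * T.trekPolynomial c b := fun a ha b hb hab =>
        trekPolynomial_eq_weight_mul hab (hc a ha b hb hab).1 (hc a ha b hb hab).2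
    rw [f i (by simp) j (by simp) h.1, f k (by simp) l (by simp) h.2, f i (by simp) l (by simp) hil,
      f k (by simp) j (by simp) hkj]
    ring
  · have h' : ¬ (T.IsTrekPair hG i l ∧ T.IsTrekPair hG k j) := fun h' =>
      h ⟨isTrekPair_of_choke hc' h'.1 h'.2, isTrekPair_of_choke hck' h'.2 h'.1⟩
    rw [not_and_or] at h h'
    have e1 : T.trekPolynomial i j * T.trekPolynomial k l = 0 := by
      rcases h with h | h <;> simp [trekPolynomial_eq_zero h]
    have e2 : T.trekPolynomial i l * T.trekPolynomial k j = 0 := by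
      rcases h' with h | h <;> simp [trekPolynomial_eq_zero h]
    rw [e1, e2]

/-- A tetrad with a choke point may be written so that the choke point is on the `I`-side. -/
theorem exists_left_choke {c i j k l : V} (h : T.IsChokePoint c {i, k} {j, l}) :
    ∃ i' j' k' l' : V, (∀ a ∈ ({i', k'} : Set V), ∀ b ∈ ({j', l'} : Set V),
        T.IsTrekPair hG a b → hG.Btw c a b ∧ ¬ T.Adj (hG.next c a) c) ∧
      σ i j * σ k l - σ i l * σ j k = σ i' j' * σ k' l' - σ i' l' * σ j' k' := by
  rcases (isChokePoint_iff hG).1 h with h | h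
  · exact ⟨i, j, k, l, h, rfl⟩
  · refine ⟨j, i, l, k, fun a ha b hb hab => ?_, ?_⟩
    · obtain ⟨h1, h2⟩ := h b hb a ha hab.symm
      exact ⟨hG.btw_comm.1 h1, h2⟩
    · rw [σ_comm j i, σ_comm l k, σ_comm i l]
      ring

theorem span_le_vanishingIdeal (hG : T.skeleton.IsTree) :
    Ideal.span (T.linearForms ∪ T.tetrads) ≤ T.vanishingIdeal := by
  rw [Ideal.span_le]
  rintro f (⟨i, j, h, rfl⟩ | ⟨i, j, k, l, ⟨c, hc⟩, rfl⟩)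
  · show T.φ _ = 0
    rw [φ_σ]
    rw [← not_nonempty_iff, nonempty_trek_iff hG] at h
    exact trekPolynomial_eq_zero h
  · obtain ⟨i', j', k', l', h, e⟩ := exists_left_choke (hG := hG) hc
    rw [e]
    exact φ_tetrad_of_left h

end DAG

/-! ### Exchange of tails at a vertex, and counts read off from exponent vectors. -/

namespace DAG

variable {V : Type*} {T : DAG V} {hG : T.skeleton.IsTree}

open scoped Classical in
variable (hG) in
/-- How the path from `v` to `i` starts: `none` if it enters a parent of `v`, and `some` of the
next vertex (`v` itself for the empty path) otherwise. -/
def start (v i : V) : Option V :=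
  if T.Adj (hG.next v i) v then none else some (hG.next v i)

theorem start_congr {v i j : V} (h : hG.next v i = hG.next v j) :
    T.start hG v i = T.start hG v j := by
  unfold start
  rw [h]

variable (hG) in
/-- The paths from `v` to `i` and to `j` can be joined to a path without collider at `v`. -/
def Compat (v i j : V) : Prop := T.start hG v i = T.start hG v j → T.start hG v i = some v

/-- All parents of `v` share the value `none` of `start`, so a single inequality excludes both
turning back along an edge and a collider at `v`. -/
theorem compat_iff {v i j : V} : T.Compat hG v i j ↔
    hG.Btw v i j ∧ ¬ (T.Adj (hG.next v i) v ∧ T.Adj (hG.next v j) v) := by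
  have := T.not_adj_self v
  unfold Compat start
  rw [hG.btw_iff]
  grind

theorem IsTrekPair.compat {v i j : V} (h : T.IsTrekPair hG i j) (hv : hG.Btw v i j) :
    T.Compat hG v i j := compat_iff.2 ⟨hv, h v hv⟩

theorem IsTrekPair.of_compat {v i j k l : V} (hij : T.IsTrekPair hG i j)
    (hkl : T.IsTrekPair hG k l) (h1 : hG.Btw v i j) (h2 : hG.Btw v k l)
    (h3 : T.Compat hG v i l) : T.IsTrekPair hG i l :=
  hij.exchange hkl h1 h2 (compat_iff.1 h3).1 (compat_iff.1 h3).2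

variable [Fintype V]

/-- All four paths pass through `v` without collider. If the one to `i` or `k` starts at a parent,
those to `j` and `l` both descend and `v` is on the right side of all treks; otherwise it is on the
left side. -/
theorem exchange_mem_span {v i j k l : V} (hij : T.IsTrekPair hG i j)
    (hkl : T.IsTrekPair hG k l) (h1 : hG.Btw v i j) (h2 : hG.Btw v k l)
    (h3 : T.Compat hG v i l) (h4 : T.Compat hG v k j) :
    σ i j * σ k l - σ i l * σ k j ∈ Ideal.span (T.linearForms ∪ T.tetrads) := by
  refine Ideal.subset_span (.inr ⟨i, j, k, l, ⟨v, (isChokePoint_iff hG).2 ?_⟩, by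
    rw [σ_comm k j]⟩)
  have c1 := hij v h1
  have c2 := hkl v h2
  rw [compat_iff] at h3 h4
  by_cases h : T.Adj (hG.next v i) v ∨ T.Adj (hG.next v k) v
  · right
    rintro a (rfl | rfl) b (rfl | rfl) - <;> tauto
  · left
    rintro a (rfl | rfl) b (rfl | rfl) - <;> tauto

/-! ### The exponent vectors of treks -/

open scoped Classical in
variable (hG) in
/-- The exponent vector of the monomial of the trek between `i` and `j`. -/
def expo (i j : V) : (V ⊕ T.Edge) →₀ ℕ :=
  Finsupp.equivFunOnFinite.symm (Sum.elim (fun t => if T.IsTopOf hG t i j then 1 else 0)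
    (fun e => if s(e.1.1, e.1.2) ∈ (hG.path i j).edges then 1 else 0))

theorem trekPolynomial_eq_monomial {i j : V} (h : T.IsTrekPair hG i j) :
    T.trekPolynomial i j = MvPolynomial.monomial (T.expo hG i j) 1 := by
  classical
  obtain ⟨t, ht⟩ := h.exists_isTopOf
  rw [trekPolynomial_eq h ht, MvPolynomial.monomial_eq, MvPolynomial.C_1, one_mul,
    Finsupp.prod_fintype _ _ (by simp), Fintype.prod_sum_type]
  congr 1
  · rw [Finset.prod_eq_single t]
    · simp [expo, ht]
    · intro t' _ hne
      have : ¬ T.IsTopOf hG t' i j := fun h' => hne (IsTopOf.eq h h' ht)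
      simp [expo, this]
    · simp
  · unfold weight
    rw [Finset.prod_filter]
    refine Finset.prod_congr rfl fun e _ => ?_
    by_cases he : s(e.1.1, e.1.2) ∈ (hG.path i j).edges <;> simp [expo, he]

open scoped Classical in
/-- The multiplicity in an exponent vector of the edge between `v` and `y`. -/
def edgeCount (T : DAG V) (v y : V) : ((V ⊕ T.Edge) →₀ ℕ) →+ ℤ :=
  if h : T.Adj v y then (Nat.castAddMonoidHom ℤ).comp (Finsupp.applyAddHom (.inr ⟨(v, y), h⟩))
  else if h : T.Adj y v then
    (Nat.castAddMonoidHom ℤ).comp (Finsupp.applyAddHom (.inr ⟨(y, v), h⟩))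
  else 0

/-- The multiplicity in an exponent vector of the top `v`. -/
def topCount (T : DAG V) (v : V) : ((V ⊕ T.Edge) →₀ ℕ) →+ ℤ :=
  (Nat.castAddMonoidHom ℤ).comp (Finsupp.applyAddHom (.inl v))

open scoped Classical in
/-- The number of treks through `v`, read off from the exponent vector. -/
def thruCount (T : DAG V) (v : V) : ((V ⊕ T.Edge) →₀ ℕ) →+ ℤ :=
  T.topCount v + ∑ u with T.Adj u v, T.edgeCount v u

/-- The number of trek ends at `v`, read off from the exponent vector. -/
def endCount (T : DAG V) (v : V) : ((V ⊕ T.Edge) →₀ ℕ) →+ ℤ :=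
  T.thruCount v + T.thruCount v - ∑ u, T.edgeCount v u

open scoped Classical in
theorem topCount_expo {v i j : V} :
    T.topCount v (T.expo hG i j) = if T.IsTopOf hG v i j then 1 else 0 := by
  simp [topCount, expo]

open scoped Classical in
theorem edgeCount_expo {v y i j : V} : T.edgeCount v y (T.expo hG i j) =
    if hG.Btw v i j ∧ y ≠ v ∧ (y = hG.next v i ∨ y = hG.next v j) then 1 else 0 := by
  simp only [← hG.mem_edges_path]
  unfold edgeCount
  split_ifs with h1 h2 h3 h4 h5
  · simp [expo, h2]
  · simp [expo, h2]
  · rw [Sym2.eq_swap] at h4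
    simp [expo, h4]
  · rw [Sym2.eq_swap] at h4
    simp [expo, h4]
  · exact absurd (skeleton_adj.1 (SimpleGraph.Walk.adj_of_mem_edges _ h5)) (by tauto)
  · rfl

-- A trek through `v` either has top `v` or enters `v` from exactly one parent.
open scoped Classical in
theorem thruCount_expo {v i j : V} (h : T.IsTrekPair hG i j) :
    T.thruCount v (T.expo hG i j) = if hG.Btw v i j then 1 else 0 := by
  unfold thruCount
  rw [AddMonoidHom.add_apply, AddMonoidHom.finsetSum_apply, topCount_expo]
  simp only [edgeCount_expo]
  by_cases hb : hG.Btw v i j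
  swap
  · simp [hb, IsTopOf]
  have hne : ∀ u, T.Adj u v → u ≠ v := by
    rintro u hu rfl
    exact T.not_adj_self _ hu
  have hc := h v hb
  by_cases h1 : T.Adj (hG.next v i) v
  · rw [Finset.sum_eq_single (hG.next v i)]
    · simp [hb, IsTopOf, h1, hne _ h1]
    · intro u hu hui
      rw [if_neg]
      rw [Finset.mem_filter_univ] at hu
      rintro ⟨-, -, rfl | rfl⟩ <;> tauto
    · simp [h1]
  by_cases h2 : T.Adj (hG.next v j) v
  · rw [Finset.sum_eq_single (hG.next v j)]
    · simp [hb, IsTopOf, h2, hne _ h2]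
    · intro u hu hui
      rw [if_neg]
      rw [Finset.mem_filter_univ] at hu
      rintro ⟨-, -, rfl | rfl⟩ <;> tauto
    · simp [h2]
  · rw [Finset.sum_eq_zero, if_pos ⟨hb, h1, h2⟩, if_pos hb, add_zero]
    intro u hu
    rw [if_neg]
    rw [Finset.mem_filter_univ] at hu
    rintro ⟨-, -, rfl | rfl⟩ <;> tauto

-- A trek through `v` has two halves at `v`, each of which uses one edge at `v` or is empty; the
-- empty ones are the ends at `v`.
open scoped Classical in
theorem endCount_expo {v i j : V} (h : T.IsTrekPair hG i j) :
    T.endCount v (T.expo hG i j) = (if v = i then 1 else 0) + (if v = j then 1 else 0) := by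
  unfold endCount
  rw [AddMonoidHom.sub_apply, AddMonoidHom.add_apply, AddMonoidHom.finsetSum_apply,
    thruCount_expo h]
  simp only [edgeCount_expo]
  by_cases hb : hG.Btw v i j
  swap
  · have hi : v ≠ i := fun h' => hb (h' ▸ hG.btw_left _ _)
    have hj : v ≠ j := fun h' => hb (h' ▸ hG.btw_right _ _)
    simp [hb, hi, hj]
  have key : ∀ u, (if hG.Btw v i j ∧ u ≠ v ∧ (u = hG.next v i ∨ u = hG.next v j) then (1 : ℤ)
      else 0) = (if u = hG.next v i then (if v = i then 0 else 1) else 0) +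
        (if u = hG.next v j then (if v = j then 0 else 1) else 0) := by
    intro u
    have h1 : hG.next v i = v ↔ v = i := hG.next_eq_self
    have h2 : hG.next v j = v ↔ v = j := hG.next_eq_self
    have h3 := hG.btw_iff.1 hb
    grind
  rw [Finset.sum_congr rfl fun u _ => key u]
  simp only [Finset.sum_add_distrib, Finset.sum_ite_eq', Finset.mem_univ, if_true, hb]
  split_ifs <;> norm_num

open scoped Classical in
/-- The number of trek halves at `v` that start with `y`, read off from the exponent vector. -/
def startCount (T : DAG V) (v y : V) : ((V ⊕ T.Edge) →₀ ℕ) →+ ℤ :=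
  if y = v then T.endCount v else T.edgeCount v y

open scoped Classical in
theorem startCount_expo {v y i j : V} (h : T.IsTrekPair hG i j) :
    T.startCount v y (T.expo hG i j) =
      if hG.Btw v i j then
        (if hG.next v i = y then 1 else 0) + (if hG.next v j = y then 1 else 0) else 0 := by
  have h1 : hG.next v i = v ↔ v = i := hG.next_eq_self
  have h2 : hG.next v j = v ↔ v = j := hG.next_eq_self
  unfold startCount
  by_cases hb : hG.Btw v i j
  · have h3 := hG.btw_iff.1 hb
    by_cases h4 : y = v
    · rw [if_pos h4, endCount_expo h]
      grind
    · rw [if_neg h4, edgeCount_expo]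
      grind
  · obtain ⟨-, hi, hj⟩ := hG.not_btw_iff.1 hb
    rw [if_neg hb]
    by_cases h4 : y = v
    · rw [if_pos h4, endCount_expo h, if_neg hi, if_neg hj, add_zero]
    · rw [if_neg h4, edgeCount_expo, if_neg (by tauto)]

open scoped Classical in
/-- The number of treks through `v` none of whose halves at `v` starts with `e`, read off from the
exponent vector. -/
def avoidCount (T : DAG V) (v : V) : Option V → ((V ⊕ T.Edge) →₀ ℕ) →+ ℤ
  | none => T.topCount v
  | some w => T.thruCount v - T.edgeCount v w

-- Avoiding all parents means having top `v`; a single edge is used at most once, so its count can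
-- be subtracted. The excluded value `some v` stands for an empty half, which `edgeCount` does not
-- see.
open scoped Classical in
theorem avoidCount_expo {v l i j : V} (hl : T.start hG v l ≠ some v) (h : T.IsTrekPair hG i j) :
    T.avoidCount v (T.start hG v l) (T.expo hG i j) =
      if hG.Btw v i j ∧ T.start hG v i ≠ T.start hG v l ∧ T.start hG v j ≠ T.start hG v l
        then 1 else 0 := by
  by_cases hn : T.Adj (hG.next v l) v
  · have e : T.start hG v l = none := by simp [start, hn]
    rw [e]
    show T.topCount v _ = _
    rw [topCount_expo]
    congr 1
    simp [start, IsTopOf]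
  · have e : T.start hG v l = some (hG.next v l) := by simp [start, hn]
    rw [e] at hl ⊢
    have hne : hG.next v l ≠ v := fun h => hl (by rw [h])
    show (T.thruCount v - T.edgeCount v (hG.next v l)) _ = _
    rw [AddMonoidHom.sub_apply, thruCount_expo h, edgeCount_expo]
    have key : ∀ i, T.start hG v i = some (hG.next v l) ↔ hG.next v l = hG.next v i := by
      intro i
      unfold start
      grind
    simp only [ne_eq, key]
    grind

end DAG

/-! ### Connecting monomials with equal image by exchanges. -/

namespace DAG

variable {V : Type*}

/-- The product of the variables `σ_ij` over a multiset of pairs. -/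
def pairMonomial (M : Multiset (V × V)) : CovRing V := (M.map fun p => σ p.1 p.2).prod

theorem pairMonomial_cons (i j : V) (M : Multiset (V × V)) :
    pairMonomial ((i, j) ::ₘ M) = σ i j * pairMonomial M := by
  simp [pairMonomial]

variable {T : DAG V} {hG : T.skeleton.IsTree}

variable (hG) in
/-- All pairs of the multiset are joined by treks. -/
def AllTreks (M : Multiset (V × V)) : Prop := ∀ p ∈ M, T.IsTrekPair hG p.1 p.2

theorem allTreks_cons {i j : V} {M : Multiset (V × V)} :
    T.AllTreks hG ((i, j) ::ₘ M) ↔ T.IsTrekPair hG i j ∧ T.AllTreks hG M := by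
  simp [AllTreks]

/-- Since σ is symmetric, a chosen pair may be oriented to suit `Q`. -/
theorem AllTreks.exists_eq_cons {M : Multiset (V × V)} (hM : T.AllTreks hG M)
    {Q : V → V → Prop} {p : V × V} (hp : p ∈ M) (hQ : Q p.1 p.2 ∨ Q p.2 p.1) :
    ∃ k z M', Q k z ∧ T.IsTrekPair hG k z ∧ T.AllTreks hG M' ∧ M = p ::ₘ M' ∧
      pairMonomial M = σ k z * pairMonomial M' ∧ (p = (k, z) ∨ p = (z, k)) := by
  obtain ⟨M', rfl⟩ := Multiset.exists_cons_of_mem hp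
  obtain ⟨a, b⟩ := p
  rw [allTreks_cons] at hM
  rcases hQ with h | h
  · exact ⟨a, b, M', h, hM.1, hM.2, rfl, pairMonomial_cons _ _ _, .inl rfl⟩
  · exact ⟨b, a, M', h, hM.1.symm, hM.2, rfl, by rw [pairMonomial_cons, σ_comm], .inr rfl⟩

theorem exists_mem_of_sum_pos {M : Multiset (V × V)} {f : V × V → ℤ}
    (h : 0 < (M.map f).sum) : ∃ p ∈ M, 0 < f p := by
  by_contra! hc
  refine absurd h (not_lt.2 ?_)
  refine (Multiset.sum_map_le_sum_map f 0 hc).trans ?_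
  simp

variable [Fintype V]

theorem AllTreks.φ_pairMonomial {M : Multiset (V × V)} (hM : T.AllTreks hG M) :
    T.φ (pairMonomial M) =
      MvPolynomial.monomial (M.map fun p => T.expo hG p.1 p.2).sum 1 := by
  induction M using Multiset.induction with
  | empty => simp [pairMonomial]
  | cons p M ih =>
    obtain ⟨i, j⟩ := p
    rw [allTreks_cons] at hM
    rw [pairMonomial_cons, map_mul, ih hM.2, φ_σ, trekPolynomial_eq_monomial hM.1,
      MvPolynomial.monomial_mul, Multiset.map_cons, Multiset.sum_cons, one_mul]

/-- Additive functions of the exponent vectors agree on monomials with the same image. -/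
theorem AllTreks.sum_eq_sum {M N : Multiset (V × V)} (hM : T.AllTreks hG M)
    (hN : T.AllTreks hG N) (h : T.φ (pairMonomial M) = T.φ (pairMonomial N))
    (F : ((V ⊕ T.Edge) →₀ ℕ) →+ ℤ) :
    (M.map fun p => F (T.expo hG p.1 p.2)).sum = (N.map fun p => F (T.expo hG p.1 p.2)).sum := by
  rw [hM.φ_pairMonomial, hN.φ_pairMonomial] at h
  have h' := MvPolynomial.monomial_left_injective one_ne_zero h
  have := congrArg F h'
  simpa [map_multiset_sum, Multiset.map_map] using this

theorem AllTreks.apply_le_sum {M : Multiset (V × V)} (hM : T.AllTreks hG M) {i j : V}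
    (hij : (i, j) ∈ M) {F : ((V ⊕ T.Edge) →₀ ℕ) →+ ℤ}
    (hF : ∀ i j, T.IsTrekPair hG i j → 0 ≤ F (T.expo hG i j)) :
    F (T.expo hG i j) ≤ (M.map fun p => F (T.expo hG p.1 p.2)).sum := by
  refine Multiset.single_le_sum (s := M.map fun p => F (T.expo hG p.1 p.2)) ?_
    (F (T.expo hG i j)) (Multiset.mem_map.2 ⟨(i, j), hij, rfl⟩)
  intro x hx
  obtain ⟨p, hp, rfl⟩ := Multiset.mem_map.1 hx
  exact hF _ _ (hM p hp)

theorem startCount_expo_nonneg (v y : V) {i j : V} (h : T.IsTrekPair hG i j) :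
    0 ≤ T.startCount v y (T.expo hG i j) := by
  rw [startCount_expo h]
  split_ifs <;> norm_num

theorem avoidCount_expo_nonneg {v l i j : V} (hl : T.start hG v l ≠ some v)
    (h : T.IsTrekPair hG i j) : 0 ≤ T.avoidCount v (T.start hG v l) (T.expo hG i j) := by
  rw [avoidCount_expo hl h]
  split_ifs <;> norm_num

theorem startCount_expo_pos {v y i j : V} (h : T.IsTrekPair hG i j)
    (hpos : 0 < T.startCount v y (T.expo hG i j)) :
    hG.Btw v i j ∧ (hG.next v i = y ∨ hG.next v j = y) := by
  rw [startCount_expo h] at hpos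
  grind

/-- A trek of `N` through `v` can be modified by exchanges so that it leaves `v` in the same
direction as a given trek with the same beginning. -/
theorem AllTreks.exists_exchange {M N : Multiset (V × V)} {i j l v : V} (hM : T.AllTreks hG M)
    (hil : T.IsTrekPair hG i l) (hN : T.AllTreks hG N)
    (h : T.φ (pairMonomial M) = T.φ (pairMonomial ((i, l) ::ₘ N)))
    (hij : (i, j) ∈ M) (hv : hG.Btw v i j) (hvl : hG.Btw v i l) :
    ∃ k N', T.IsTrekPair hG i k ∧ T.AllTreks hG N' ∧ hG.Btw v i k ∧ hG.next v k = hG.next v j ∧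
      pairMonomial ((i, l) ::ₘ N) - pairMonomial ((i, k) ::ₘ N') ∈
        Ideal.span (T.linearForms ∪ T.tetrads) := by
  classical
  by_cases hlj : hG.next v l = hG.next v j
  · exact ⟨l, N, hil, hN, hvl, hlj, by simp⟩
  have hN' : T.AllTreks hG ((i, l) ::ₘ N) := allTreks_cons.2 ⟨hil, hN⟩
  have hijT := hM _ hij
  -- The trek `(i, j)` has one more half at `v` starting towards `j` than `(i, l)` has, so some trek
  -- of `N` supplies such a half; it is oriented as `(k, z)`.
  have hcount := hM.sum_eq_sum hN' h (T.startCount v (hG.next v j))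
  have hle := hM.apply_le_sum hij fun _ _ => startCount_expo_nonneg v (hG.next v j)
  rw [hcount, Multiset.map_cons, Multiset.sum_cons, startCount_expo hijT, startCount_expo hil,
    if_pos hv, if_pos hvl, if_neg hlj, if_pos rfl] at hle
  obtain ⟨p, hp, hpos⟩ := exists_mem_of_sum_pos (M := N)
    (f := fun p => T.startCount v (hG.next v j) (T.expo hG p.1 p.2)) (by linarith)
  obtain ⟨hpv, hpj⟩ := startCount_expo_pos (hN p hp) hpos
  obtain ⟨k, z, N₁, ⟨hkj, hvk⟩, hkz, hN₁, e, eN, hpk⟩ := hN.exists_eq_cons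
    (Q := fun a b => hG.next v a = hG.next v j ∧ hG.Btw v a b) hp
    (hpj.imp (fun h => ⟨h, hpv⟩) fun h => ⟨h, hG.btw_comm.1 hpv⟩)
  have hcij := hijT.compat hv
  have hcil := hil.compat hvl
  have hckz := hkz.compat hvk
  have hsk : T.start hG v k = T.start hG v j := start_congr hkj
  have hcik : T.Compat hG v i k := by
    unfold Compat at hcij ⊢
    rwa [hsk]
  have hik : T.IsTrekPair hG i k :=
    hil.of_compat hkz.symm hvl (hG.btw_comm.1 hvk) hcik
  -- If the leftover halves fit, a single exchange of `(i, l)`, `(k, z)` into `(i, k)`, `(z, l)`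
  -- suffices.
  by_cases hzl : T.Compat hG v z l
  · refine ⟨k, (z, l) ::ₘ N₁, hik, allTreks_cons.2 ⟨?_, hN₁⟩, (compat_iff.1 hcik).1, hkj, ?_⟩
    · exact hkz.symm.of_compat hil (hG.btw_comm.1 hvk) hvl hzl
    · have hmem := exchange_mem_span hil hkz.symm hvl (hG.btw_comm.1 hvk) hcik hzl
      have := Ideal.mul_mem_right (pairMonomial N₁) _ hmem
      rw [pairMonomial_cons, pairMonomial_cons, pairMonomial_cons, eN, σ_comm k z]
      convert this using 1
      ring
  unfold Compat at hzl
  push Not at hzl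
  obtain ⟨hsz, hsv⟩ := hzl
  rw [hsz] at hsv
  have hsi : T.start hG v i ≠ T.start hG v l := fun h' => hsv (h' ▸ hcil h')
  have hsk' : T.start hG v k ≠ T.start hG v l := by
    intro h'
    exact hsv (h' ▸ hckz (h'.trans hsz.symm))
  -- Now `z` and `l` clash: they start alike at `v`. As `(i, j)` avoids this start, some trek `q` on
  -- the other side does too, and it is neither `(i, l)` nor `(k, z)`.
  have hcount' := hM.sum_eq_sum hN' h (T.avoidCount v (T.start hG v l))
  have hle' := hM.apply_le_sum hij fun _ _ => avoidCount_expo_nonneg hsv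
  rw [hcount', avoidCount_expo hsv hijT, if_pos ⟨hv, hsi, hsk ▸ hsk'⟩] at hle'
  obtain ⟨q, hq, hqpos⟩ := exists_mem_of_sum_pos (M := (i, l) ::ₘ N)
    (f := fun p => T.avoidCount v (T.start hG v l) (T.expo hG p.1 p.2)) (by linarith)
  rw [avoidCount_expo hsv (hN' q hq)] at hqpos
  have hqa : hG.Btw v q.1 q.2 ∧ T.start hG v q.1 ≠ T.start hG v l ∧
      T.start hG v q.2 ≠ T.start hG v l := by
    by_contra hcon
    rw [if_neg hcon] at hqpos
    exact lt_irrefl _ hqpos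
  obtain ⟨hqv, hq1, hq2⟩ := hqa
  have hqN : q ∈ N₁ := by
    rw [Multiset.mem_cons, e, Multiset.mem_cons] at hq
    rcases hq with rfl | rfl | hq
    · exact absurd rfl hq2
    · rcases hpk with rfl | rfl
      · exact absurd hsz hq2
      · exact absurd hsz hq1
    · exact hq
  have hqc := (hN₁ q hqN).compat hqv
  -- The two ends of `q` are compatible with each other, so `i` cannot clash with both; `c` is an
  -- end with which it does not.
  obtain ⟨c, d, N₂, ⟨hic, hvc, hc, hd⟩, hcd, hN₂, -, eN₁, -⟩ := hN₁.exists_eq_cons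
    (Q := fun a b => T.Compat hG v i a ∧ hG.Btw v a b ∧ T.start hG v a ≠ T.start hG v l ∧
      T.start hG v b ≠ T.start hG v l) hqN (by
        have hqv' := hG.btw_comm.1 hqv
        by_cases h1 : T.Compat hG v i q.1
        · exact .inl ⟨h1, hqv, hq1, hq2⟩
        · refine .inr ⟨?_, hqv', hq2, hq1⟩
          unfold Compat at h1 hqc ⊢
          grind)
  have hdl : T.Compat hG v d l := fun h' => absurd h' hd
  have hzc : T.Compat hG v z c := fun h' => absurd (h'.symm.trans hsz) hc
  have hvdc := hG.btw_comm.1 hvc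
  have hvzk := hG.btw_comm.1 hvk
  have hic' : T.IsTrekPair hG i c := hil.of_compat hcd.symm hvl hvdc hic
  have hvic := (compat_iff.1 hic).1
  refine ⟨k, (z, c) ::ₘ (d, l) ::ₘ N₂, hik, allTreks_cons.2 ⟨?_, allTreks_cons.2 ⟨?_, hN₂⟩⟩,
    (compat_iff.1 hcik).1, hkj, ?_⟩
  · exact hkz.symm.of_compat hcd.symm hvzk hvdc hzc
  · exact hcd.symm.of_compat hil hvdc hvl hdl
  -- Two exchanges via `q`: `(i, l)`, `(d, c)` become `(i, c)`, `(d, l)`, and then `(i, c)`, `(z,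
  -- k)` become `(i, k)`, `(z, c)`.
  · have m1 := exchange_mem_span hil hcd.symm hvl hvdc hic hdl
    have m2 := exchange_mem_span hic' hkz.symm hvic hvzk hcik hzc
    have := Ideal.add_mem _ (Ideal.mul_mem_right (σ z k * pairMonomial N₂) _ m1)
      (Ideal.mul_mem_right (σ d l * pairMonomial N₂) _ m2)
    simp only [pairMonomial_cons]
    rw [eN, eN₁, σ_comm k z, σ_comm c d]
    convert this using 1
    ring

theorem φ_eq_of_sub_mem (hG : T.skeleton.IsTree) {f g : CovRing V}
    (h : f - g ∈ Ideal.span (T.linearForms ∪ T.tetrads)) : T.φ f = T.φ g := by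
  have := span_le_vanishingIdeal hG h
  rw [← sub_eq_zero, ← map_sub]
  exact this

/-- Extraction of a given trek along its path. -/
theorem AllTreks.exists_extract_of_btw {M N : Multiset (V × V)} {i j l v : V}
    (hM : T.AllTreks hG M) (hil : T.IsTrekPair hG i l) (hN : T.AllTreks hG N)
    (h : T.φ (pairMonomial M) = T.φ (pairMonomial ((i, l) ::ₘ N)))
    (hij : (i, j) ∈ M) (hv : hG.Btw v i j) (hvl : hG.Btw v i l) :
    ∃ N', T.AllTreks hG N' ∧ pairMonomial ((i, l) ::ₘ N) - pairMonomial ((i, j) ::ₘ N') ∈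
        Ideal.span (T.linearForms ∪ T.tetrads) := by
  -- The vertex `v`, up to which the rebuilt trek agrees with `(i, j)`, moves one edge towards `j`
  -- at each exchange.
  induction hn : (hG.path v j).length generalizing v l N with
  | zero =>
    have : v = j := SimpleGraph.Walk.eq_of_length_eq_zero hn
    subst this
    obtain ⟨k, N', hik, hN', hvk, hk, hmem⟩ := hM.exists_exchange hil hN h hij hv hvl
    rw [hG.next_self, hG.next_eq_self] at hk
    subst hk
    exact ⟨N', hN', hmem⟩
  | succ n ih =>
    have hne : v ≠ j := by
      rintro rfl
      rw [hG.path_self] at hn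
      simp at hn
    obtain ⟨k, N', hik, hN', hvk, hk, hmem⟩ := hM.exists_exchange hil hN h hij hv hvl
    rw [hG.length_path hne] at hn
    obtain ⟨N₂, hN₂, hmem₂⟩ := ih hik hN' (h.trans (φ_eq_of_sub_mem hG hmem))
      (hG.btw_trans_right (hG.btw_next v j) hv)
      (hG.btw_trans_right (hk ▸ hG.btw_next v k) hvk) (by omega)
    refine ⟨N₂, hN₂, ?_⟩
    rw [← sub_add_sub_cancel]
    exact Ideal.add_mem _ hmem hmem₂

theorem AllTreks.exists_extract {M N : Multiset (V × V)} {i j : V}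
    (hM : T.AllTreks hG M) (hN : T.AllTreks hG N)
    (h : T.φ (pairMonomial M) = T.φ (pairMonomial N)) (hij : (i, j) ∈ M) :
    ∃ N', T.AllTreks hG N' ∧ pairMonomial N - pairMonomial ((i, j) ::ₘ N') ∈
        Ideal.span (T.linearForms ∪ T.tetrads) := by
  classical
  -- `startCount i i` counts ends at `i`, so `N` too has a trek ending at `i`.
  have hcount := hM.sum_eq_sum hN h (T.startCount i i)
  have hle := hM.apply_le_sum hij fun _ _ => startCount_expo_nonneg i i
  rw [hcount, startCount_expo (hM _ hij), if_pos (hG.btw_left i j), hG.next_self, if_pos rfl] at hle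
  obtain ⟨p, hp, hpos⟩ := exists_mem_of_sum_pos (M := N)
    (f := fun p => T.startCount i i (T.expo hG p.1 p.2)) (by
      have : (0 : ℤ) ≤ if hG.next i j = i then 1 else 0 := by split_ifs <;> norm_num
      linarith)
  obtain ⟨hpv, hpj⟩ := startCount_expo_pos (hN p hp) hpos
  rw [hG.next_eq_self, hG.next_eq_self] at hpj
  obtain ⟨k, l, N₁, rfl, hkl, hN₁, -, eN, -⟩ := hN.exists_eq_cons (Q := fun a _ => i = a) hp hpj
  rw [← pairMonomial_cons] at eN
  rw [eN] at h ⊢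
  exact hM.exists_extract_of_btw hkl hN₁ h hij (hG.btw_left _ _) (hG.btw_left _ _)

theorem expo_ne_zero {i j : V} (h : T.IsTrekPair hG i j) : T.expo hG i j ≠ 0 := by
  classical
  obtain ⟨t, ht⟩ := h.exists_isTopOf
  intro h0
  have := topCount_expo (hG := hG) (v := t) (i := i) (j := j)
  rw [h0, map_zero, if_pos ht] at this
  exact zero_ne_one this

/-- Two monomials with the same image are congruent modulo the tetrads. -/
theorem AllTreks.sub_mem_span {M N : Multiset (V × V)} (hM : T.AllTreks hG M)
    (hN : T.AllTreks hG N) (h : T.φ (pairMonomial M) = T.φ (pairMonomial N)) :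
    pairMonomial M - pairMonomial N ∈ Ideal.span (T.linearForms ∪ T.tetrads) := by
  induction M using Multiset.induction generalizing N with
  | empty =>
    rcases Multiset.empty_or_exists_mem N with rfl | ⟨⟨i, j⟩, hp⟩
    · simp
    exfalso
    rw [hM.φ_pairMonomial, hN.φ_pairMonomial] at h
    have h' := MvPolynomial.monomial_left_injective one_ne_zero h
    rw [Multiset.map_zero, Multiset.sum_zero] at h'
    obtain ⟨N', rfl⟩ := Multiset.exists_cons_of_mem hp
    rw [Multiset.map_cons, Multiset.sum_cons] at h'
    refine expo_ne_zero (hN _ hp) ?_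
    ext x
    have := DFunLike.congr_fun h' x
    simp only [Finsupp.coe_zero, Pi.zero_apply, Finsupp.add_apply] at this ⊢
    omega
  | cons p M ih =>
    obtain ⟨i, j⟩ := p
    obtain ⟨N', hN', hmem⟩ := hM.exists_extract hN h (Multiset.mem_cons_self _ _)
    have hM' := allTreks_cons.1 hM
    have h2 := h.trans (φ_eq_of_sub_mem hG hmem)
    have hne : T.φ (σ i j) ≠ 0 := by
      rw [φ_σ, trekPolynomial_eq_monomial hM'.1]
      simp
    rw [pairMonomial_cons, pairMonomial_cons, map_mul, map_mul] at h2
    have := Ideal.mul_mem_left _ (σ i j) (ih hM'.2 hN' (mul_left_cancel₀ hne h2))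
    have h3 := Ideal.sub_mem _ this hmem
    rw [pairMonomial_cons] at h3 ⊢
    convert h3 using 1
    ring

end DAG

/-! ### Generators as minors, and the kernel of φ. -/

namespace DAG

variable {V : Type*}

theorem exists_monomial_eq_pairMonomial (m : Sym2 V →₀ ℕ) :
    ∃ M : Multiset (V × V), MvPolynomial.monomial m (1 : ℂ) = pairMonomial M := by
  induction m using Finsupp.induction_linear with
  | zero => exact ⟨0, by simp [pairMonomial]⟩
  | add f g hf hg =>
    obtain ⟨M, hM⟩ := hf
    obtain ⟨N, hN⟩ := hg
    refine ⟨M + N, ?_⟩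
    have : pairMonomial (M + N) = pairMonomial M * pairMonomial N := by simp [pairMonomial]
    rw [this, ← hM, ← hN, MvPolynomial.monomial_mul, one_mul]
  | single s n =>
    induction s with
    | h i j =>
      refine ⟨Multiset.replicate n (i, j), ?_⟩
      simp [pairMonomial, σ, MvPolynomial.X_pow_eq_monomial]

variable {T : DAG V} {hG : T.skeleton.IsTree}

/-! ### Linear forms and tetrads as conditional independence constraints -/

theorem det_submatrix_mem_ciIdeal {A B C : Finset V} (hAB : Disjoint A B) (hAC : Disjoint A C)
    (hBC : Disjoint B C) (h : T.DSeparates C A B) {n : ℕ} (hn : C.card + 1 = n)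
    (r c : Fin n ↪ V) (hr : ∀ k, r k ∈ A ∨ r k ∈ C) (hc : ∀ k, c k ∈ B ∨ c k ∈ C) :
    ((covMatrix V).submatrix r c).det ∈ T.ciIdeal := by
  subst hn
  exact Ideal.subset_span ⟨A, B, C, hAB, hAC, hBC, h, r, c, hr, hc, rfl⟩

/-- Given the empty set every collider blocks, so `σ i j` is an admissible 1×1 minor. -/
theorem σ_mem_ciIdeal {i j : V} (h : ¬ T.IsTrekPair hG i j) : σ i j ∈ T.ciIdeal := by
  classical
  have hne : i ≠ j := by
    rintro rfl
    exact h (isTrekPair_self i)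
  have hdet := det_submatrix_mem_ciIdeal (T := T) (A := {i}) (B := {j}) (C := ∅)
    (by simpa using hne) (by simp) (by simp) ?_ (n := 1) (by simp)
    ⟨fun _ => i, fun a b _ => Subsingleton.elim a b⟩
    ⟨fun _ => j, fun a b _ => Subsingleton.elim a b⟩ (fun _ => .inl (Finset.mem_singleton_self i))
    (fun _ => .inl (Finset.mem_singleton_self j))
  · rw [Matrix.det_unique] at hdet
    exact hdet
  · intro a ha b hb p hp
    rw [Finset.mem_singleton] at ha hb
    subst ha hb
    unfold IsTrekPair at h
    push Not at h
    obtain ⟨u, hu, h1, h2⟩ := h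
    rw [hG.eq_path hp]
    exact ⟨u, hu, .inr ⟨(isCollider_path hG).2 ⟨hu, h1, h2⟩, by simp, by simp⟩⟩

/-- As a non-collider on all four paths, `c` d-separates, and the tetrad is a 2×2 minor. Rows or
columns equal to `c` belong to the conditioning set, whence `erase`; repeated ones make the tetrad
zero. -/
theorem tetrad_mem_ciIdeal {c i j k l : V}
    (hc : ∀ a ∈ ({i, k} : Set V), ∀ b ∈ ({j, l} : Set V),
      T.IsTrekPair hG a b ∧ hG.Btw c a b) :
    σ i j * σ k l - σ i l * σ j k ∈ T.ciIdeal := by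
  classical
  by_cases hik : i = k
  · subst hik
    rw [σ_comm j i, mul_comm, sub_self]
    exact Ideal.zero_mem _
  by_cases hjl : j = l
  · subst hjl
    rw [σ_comm j k, sub_self]
    exact Ideal.zero_mem _
  have hi : ∀ (a b : V), a ≠ b → Function.Injective (![a, b] : Fin 2 → V) := by
    intro a b hab x y
    fin_cases x <;> fin_cases y <;> simp [hab, hab.symm]
  have hmem : ∀ (a b : V) (x : Fin 2), (![a, b] : Fin 2 → V) x ∈ ({a, b} : Finset V).erase c ∨
      (![a, b] : Fin 2 → V) x ∈ ({c} : Finset V) := by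
    intro a b x
    simp only [Finset.mem_erase, Finset.mem_insert, Finset.mem_singleton]
    fin_cases x <;> simp <;> tauto
  have hdet := det_submatrix_mem_ciIdeal (T := T) (A := ({i, k} : Finset V).erase c)
    (B := ({j, l} : Finset V).erase c) (C := {c}) ?_ (by simp) (by simp) ?_ (n := 2) (by simp)
    ⟨![i, k], hi i k hik⟩ ⟨![j, l], hi j l hjl⟩ (hmem i k) (hmem j l)
  · rw [Matrix.det_fin_two] at hdet
    rw [σ_comm j k]
    exact hdet
  · rw [Finset.disjoint_left]
    intro x hx hx'
    rw [Finset.mem_erase] at hx hx'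
    have := (hc x (by simpa using hx.2) x (by simpa using hx'.2)).2
    rw [hG.btw_self] at this
    exact hx.1 this.symm
  · intro a ha b hb p hp
    rw [Finset.mem_erase] at ha hb
    obtain ⟨h1, h2⟩ := hc a (by simpa using ha.2) b (by simpa using hb.2)
    rw [hG.eq_path hp]
    refine ⟨c, h2, .inl ⟨fun h => ?_, by simp⟩⟩
    exact h1 c h2 ((isCollider_path hG).1 h).2

/-! ### The vanishing ideal is generated by linear forms and tetrads -/

variable [Fintype V]

theorem pairMonomial_mem_of_not_allTreks {M : Multiset (V × V)} (hM : ¬ T.AllTreks hG M) :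
    pairMonomial M ∈ Ideal.span (T.linearForms ∪ T.tetrads) := by
  unfold AllTreks at hM
  push Not at hM
  obtain ⟨⟨i, j⟩, hp, h⟩ := hM
  obtain ⟨M', rfl⟩ := Multiset.exists_cons_of_mem hp
  rw [pairMonomial_cons]
  refine Ideal.mul_mem_right _ _ (Ideal.subset_span (.inl ⟨i, j, ?_, rfl⟩))
  rwa [← not_nonempty_iff, nonempty_trek_iff hG]

/-- The vanishing ideal of a polytree is generated by linear forms and tetrads. -/
theorem vanishingIdeal_le_span (hG : T.skeleton.IsTree) :
    T.vanishingIdeal ≤ Ideal.span (T.linearForms ∪ T.tetrads) := by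
  classical
  set J := Ideal.span (T.linearForms ∪ T.tetrads) with hJ
  -- A linear map with ψ ∘ φ equal to the quotient map forces ker φ ⊆ J. It sends a monomial to the
  -- class of some product of trek variables above it; by `AllTreks.sub_mem_span` the choice does
  -- not matter.
  let ψ : T.ParamRing →ₗ[ℂ] (CovRing V ⧸ J) := (MvPolynomial.basisMonomials _ ℂ).constr ℂ fun b =>
    if h : ∃ M : Multiset (V × V), T.AllTreks hG M ∧
        T.φ (pairMonomial M) = MvPolynomial.monomial b 1
    then Ideal.Quotient.mkₐ ℂ J (pairMonomial h.choose) else 0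
  have key : ψ ∘ₗ T.φ.toLinearMap = (Ideal.Quotient.mkₐ ℂ J).toLinearMap := by
    refine (MvPolynomial.basisMonomials _ ℂ).ext fun m => ?_
    rw [MvPolynomial.coe_basisMonomials]
    obtain ⟨M, hM⟩ := exists_monomial_eq_pairMonomial m
    show ψ (T.φ _) = Ideal.Quotient.mkₐ ℂ J _
    beta_reduce
    rw [hM]
    by_cases hT : T.AllTreks hG M
    · have h1 := hT.φ_pairMonomial
      have h : ∃ N : Multiset (V × V), T.AllTreks hG N ∧ T.φ (pairMonomial N) =
        MvPolynomial.monomial (M.map fun p => T.expo hG p.1 p.2).sum 1 := ⟨M, hT, h1⟩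
      have h2 := (MvPolynomial.basisMonomials (V ⊕ T.Edge) ℂ).constr_basis ℂ (fun b =>
        if h : ∃ M : Multiset (V × V), T.AllTreks hG M ∧
          T.φ (pairMonomial M) = MvPolynomial.monomial b 1
        then Ideal.Quotient.mkₐ ℂ J (pairMonomial h.choose) else 0)
        (M.map fun p => T.expo hG p.1 p.2).sum
      rw [MvPolynomial.coe_basisMonomials] at h2
      rw [h1]
      refine h2.trans ?_
      rw [dif_pos h]
      refine Ideal.Quotient.eq.2 ?_
      exact h.choose_spec.1.sub_mem_span hT (h.choose_spec.2.trans h1.symm)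
    · have hmem := pairMonomial_mem_of_not_allTreks hT
      have h0 : T.φ (pairMonomial M) = 0 := span_le_vanishingIdeal hG hmem
      rw [h0, map_zero]
      exact (Ideal.Quotient.eq_zero_iff_mem.2 hmem).symm
  intro f hf
  have hf0 : T.φ f = 0 := hf
  have := LinearMap.congr_fun key f
  refine Ideal.Quotient.eq_zero_iff_mem.1 ?_
  show Ideal.Quotient.mkₐ ℂ J f = 0
  have h3 : ψ (T.φ f) = Ideal.Quotient.mkₐ ℂ J f := this
  rw [← h3, hf0, map_zero]

theorem span_le_ciIdeal (hG : T.skeleton.IsTree) :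
    Ideal.span (T.linearForms ∪ T.tetrads) ≤ T.ciIdeal := by
  rw [Ideal.span_le]
  rintro f (⟨i, j, h, rfl⟩ | ⟨i, j, k, l, ⟨c, hc⟩, rfl⟩)
  · rw [← not_nonempty_iff, nonempty_trek_iff hG] at h
    exact σ_mem_ciIdeal h
  obtain ⟨i, j, k, l, h, e⟩ := exists_left_choke (hG := hG) hc
  rw [e]
  have hl : ∀ a ∈ ({i, k} : Set V), ∀ b ∈ ({l, j} : Set V), T.IsTrekPair hG a b →
      hG.Btw c a b ∧ ¬ T.Adj (hG.next c a) c := by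
    rw [Set.pair_comm l j]; exact h
  have hk : ∀ a ∈ ({k, i} : Set V), ∀ b ∈ ({j, l} : Set V), T.IsTrekPair hG a b →
      hG.Btw c a b ∧ ¬ T.Adj (hG.next c a) c := by
    rw [Set.pair_comm k i]; exact h
  have hkl : ∀ a ∈ ({k, i} : Set V), ∀ b ∈ ({l, j} : Set V), T.IsTrekPair hG a b →
      hG.Btw c a b ∧ ¬ T.Adj (hG.next c a) c := by
    rw [Set.pair_comm l j]; exact hk
  by_cases h1 : T.IsTrekPair hG i j ∧ T.IsTrekPair hG k l
  · have h2 := isTrekPair_of_choke h h1.1 h1.2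
    have h3 := isTrekPair_of_choke hkl h1.2 h1.1
    refine tetrad_mem_ciIdeal (hG := hG) (c := c) fun a ha b hb => ?_
    have hab : T.IsTrekPair hG a b := by
      rcases ha with rfl | rfl <;> rcases hb with rfl | rfl <;> tauto
    exact ⟨hab, (h a ha b hb hab).1⟩
  · have h2 : ¬ (T.IsTrekPair hG i l ∧ T.IsTrekPair hG k j) := fun h' =>
      h1 ⟨isTrekPair_of_choke hl h'.1 h'.2, isTrekPair_of_choke hk h'.2 h'.1⟩
    rw [not_and_or] at h1 h2
    rw [σ_comm j k]
    refine Ideal.sub_mem _ ?_ ?_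
    · rcases h1 with h1 | h1
      · exact Ideal.mul_mem_right _ _ (σ_mem_ciIdeal h1)
      · exact Ideal.mul_mem_left _ _ (σ_mem_ciIdeal h1)
    · rcases h2 with h1 | h1
      · exact Ideal.mul_mem_right _ _ (σ_mem_ciIdeal h1)
      · exact Ideal.mul_mem_left _ _ (σ_mem_ciIdeal h1)

end DAG

/-! ### Covariances as sums over pairs of directed paths. -/

namespace DAG

variable {V : Type*} {T : DAG V} {hG : T.skeleton.IsTree}

theorem exists_first_btw {D : Finset V} {t i c : V} (hc : c ∈ D) (hb : hG.Btw c t i) :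
    ∃ c ∈ D, hG.Btw c t i ∧ ∀ d ∈ D, hG.Btw d t c → d = c := by
  induction hn : (hG.path t c).length using Nat.strong_induction_on generalizing c with
  | _ n ih =>
    by_cases h : ∀ d ∈ D, hG.Btw d t c → d = c
    · exact ⟨c, hc, hb, h⟩
    push Not at h
    obtain ⟨d, hd, hdc, hne⟩ := h
    refine ih _ ?_ hd (hG.btw_trans_left hdc hb) rfl
    rw [← hn, ← hG.path_append hdc, SimpleGraph.Walk.length_append]
    have : (hG.path d c).length ≠ 0 := fun h => hne (SimpleGraph.Walk.eq_of_length_eq_zero h)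
    omega

/-! ### The covariance matrix in terms of error variances -/

variable [Fintype V]

open scoped Classical in
variable (hG) in
/-- The product of the edge parameters along the directed path from `t` to `i`, and zero if there
is no such path. -/
def dirWeight (t i : V) : T.ParamRing := if T.Below hG t i then T.weight hG t i else 0

theorem Below.dirWeight_eq {t i : V} (h : T.Below hG t i) :
    T.dirWeight hG t i = T.weight hG t i := if_pos h

theorem dirWeight_eq_zero {t i : V} (h : ¬ T.Below hG t i) : T.dirWeight hG t i = 0 := if_neg h

theorem Below.dirWeight_mul {t m i : V} (h : T.Below hG t m) (h' : T.Below hG m i) :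
    T.dirWeight hG t m * T.dirWeight hG m i = T.dirWeight hG t i := by
  rw [h.dirWeight_eq, h'.dirWeight_eq, (h.trans h').dirWeight_eq, weight_mul_weight (h.btw h')]

open scoped Classical in
variable (hG) in
/-- The error variance of the vertex `t`. -/
def errorVariance (t : V) : T.ParamRing :=
  MvPolynomial.X (Sum.inl t) - ∑ p with T.Adj p t, T.weight hG p t ^ 2 * MvPolynomial.X (Sum.inl p)

-- A nonempty directed path to `m` enters through exactly one parent, so the recursion over parents
-- has no cross terms after squaring.
open scoped Classical in
theorem dirWeight_sq (t m : V) : T.dirWeight hG t m ^ 2 = (if t = m then 1 else 0) +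
    ∑ p with T.Adj p m, T.weight hG p m ^ 2 * T.dirWeight hG t p ^ 2 := by
  by_cases htm : t = m
  · subst htm
    rw [(below_self t).dirWeight_eq, weight_self, if_pos rfl, Finset.sum_eq_zero, one_pow, add_zero]
    intro p hp
    rw [Finset.mem_filter_univ] at hp
    rw [dirWeight_eq_zero]
    · ring
    · intro h
      refine h.2 ?_
      rwa [hG.next_of_adj (skeleton_adj.2 (.inr hp))]
  rw [if_neg htm, zero_add]
  by_cases h : T.Below hG t m
  · have hadj := h.adj_next htm
    have hb : hG.Btw (hG.next m t) t m := hG.btw_comm.1 (hG.btw_next m t)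
    rw [Finset.sum_eq_single (hG.next m t)]
    · rw [h.dirWeight_eq, (h.left hb).dirWeight_eq, ← weight_mul_weight hb]
      ring
    · intro p hp hne
      rw [Finset.mem_filter_univ] at hp
      rw [dirWeight_eq_zero]
      · ring
      · intro hp'
        have hpm := below_of_adj (hG := hG) hp
        have hpne : m ≠ p := by
          rintro rfl
          exact T.not_adj_self _ hp
        refine hne ?_
        rw [hG.next_eq_of_btw (hG.btw_comm.1 (hp'.btw hpm)) hpne,
          hG.next_of_adj (skeleton_adj.2 (.inr hp))]
    · simp [hadj]
  · rw [dirWeight_eq_zero h, Finset.sum_eq_zero, zero_pow two_ne_zero]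
    intro p hp
    rw [Finset.mem_filter_univ] at hp
    rw [dirWeight_eq_zero fun h' => h (h'.trans (below_of_adj hp))]
    ring

/-- The parameter a_m is the total variance at `m`, and `errorVariance` removes what the parents
contribute; unrolling this along the ancestor order expresses a_m by error variances. -/
theorem X_eq_sum_errorVariance (m : V) : (MvPolynomial.X (Sum.inl m) : T.ParamRing) =
    ∑ t, T.errorVariance hG t * T.dirWeight hG t m ^ 2 := by
  classical
  have : Std.Irrefl (Relation.TransGen T.Adj) := ⟨T.acyclic⟩
  have wf : WellFounded (Relation.TransGen T.Adj) := Finite.wellFounded_of_trans_of_irrefl _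
  induction m using wf.induction with
  | h m ih =>
    simp_rw [dirWeight_sq (hG := hG) _ m, mul_add, Finset.sum_add_distrib, Finset.mul_sum]
    rw [Finset.sum_comm]
    have : ∀ p ∈ Finset.univ.filter (T.Adj · m),
        ∑ t, T.errorVariance hG t * (T.weight hG p m ^ 2 * T.dirWeight hG t p ^ 2) =
        T.weight hG p m ^ 2 * MvPolynomial.X (Sum.inl p) := by
      intro p hp
      rw [Finset.mem_filter_univ] at hp
      rw [ih p (.single hp), Finset.mul_sum]
      exact Finset.sum_congr rfl fun t _ => by ring
    rw [Finset.sum_congr rfl this]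
    simp [errorVariance]

/-- Directed paths from a common ancestor of `i` and `j` both pass through the top `m` of the trek,
so the sum is the trek weight times the expansion of a_m. -/
theorem trekPolynomial_eq_sum_errorVariance (hG : T.skeleton.IsTree) (i j : V) :
    T.trekPolynomial i j =
      ∑ t, T.errorVariance hG t * T.dirWeight hG t i * T.dirWeight hG t j := by
  by_cases h : T.IsTrekPair hG i j
  · obtain ⟨m, hm⟩ := h.exists_isTopOf
    obtain ⟨hi, hj⟩ := hm.below h
    have key : ∀ t, T.dirWeight hG t i * T.dirWeight hG t j =
        T.dirWeight hG t m ^ 2 * T.weight hG i j := by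
      intro t
      by_cases htm : T.Below hG t m
      · rw [← htm.dirWeight_mul hi, ← htm.dirWeight_mul hj, ← weight_mul_weight hm.1,
          hi.dirWeight_eq, hj.dirWeight_eq, weight_comm i m]
        ring
      · rw [dirWeight_eq_zero htm]
        have : ¬ (T.Below hG t i ∧ T.Below hG t j) := fun h' =>
          htm (h'.1.left (hm.btw h'.1 h'.2).1)
        rw [not_and_or] at this
        rcases this with h' | h' <;> rw [dirWeight_eq_zero h'] <;> ring
    rw [trekPolynomial_eq h hm, X_eq_sum_errorVariance (hG := hG) m, Finset.sum_mul]
    refine Finset.sum_congr rfl fun t _ => ?_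
    rw [mul_assoc (T.errorVariance hG t) (T.dirWeight hG t i), key]
    ring
  · rw [trekPolynomial_eq_zero h, Finset.sum_eq_zero]
    intro t _
    have : ¬ (T.Below hG t i ∧ T.Below hG t j) := fun h' => h (h'.1.isTrekPair h'.2)
    rw [not_and_or] at this
    rcases this with h' | h' <;> rw [dirWeight_eq_zero h'] <;> ring

/-! ### Splitting directed paths at their first vertex in a set -/

open scoped Classical in
variable (hG) in
/-- The weight of the directed path from `t` to `i` if it avoids `D`, and zero otherwise. -/
def avoidWeight (D : Finset V) (t i : V) : T.ParamRing :=
  if ∀ d ∈ D, ¬ hG.Btw d t i then T.dirWeight hG t i else 0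

open scoped Classical in
variable (hG) in
/-- The weight of the directed path from `t` to `c` if it meets `D` at most in `c`, and zero
otherwise. -/
def hitWeight (D : Finset V) (t c : V) : T.ParamRing :=
  if ∀ d ∈ D, hG.Btw d t c → d = c then T.dirWeight hG t c else 0

theorem dirWeight_eq_add_sum (D : Finset V) (t i : V) : T.dirWeight hG t i =
    T.avoidWeight hG D t i + ∑ c ∈ D, T.hitWeight hG D t c * T.dirWeight hG c i := by
  classical
  by_cases h : ∀ d ∈ D, ¬ hG.Btw d t i
  · rw [avoidWeight, if_pos h, Finset.sum_eq_zero, add_zero]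
    intro c hc
    by_cases h1 : T.Below hG t c
    · rw [dirWeight_eq_zero fun h2 => h c hc (h1.btw h2), mul_zero]
    · rw [hitWeight, dirWeight_eq_zero h1]
      simp
  · rw [avoidWeight, if_neg h, zero_add]
    push Not at h
    obtain ⟨d, hd, hb⟩ := h
    obtain ⟨c, hc, hcb, hfirst⟩ := exists_first_btw hd hb
    rw [Finset.sum_eq_single c]
    · rw [hitWeight, if_pos hfirst]
      by_cases hti : T.Below hG t i
      · rw [(hti.left hcb).dirWeight_mul (hti.right hcb)]
      · rw [dirWeight_eq_zero hti]
        by_cases h1 : T.Below hG t c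
        · rw [dirWeight_eq_zero fun h2 => hti (h1.trans h2), mul_zero]
        · rw [dirWeight_eq_zero h1, zero_mul]
    · intro c' hc' hne
      by_cases h0 : ∀ d ∈ D, hG.Btw d t c' → d = c'
      swap
      · rw [hitWeight, if_neg h0, zero_mul]
      by_cases h1 : T.Below hG t c'
      swap
      · rw [hitWeight, dirWeight_eq_zero h1]
        simp
      rw [dirWeight_eq_zero, mul_zero]
      intro h2
      have hb' := h1.btw h2
      rcases hG.btw_or hcb c' with h3 | h3
      · exact hne (h0 c hc h3).symm
      · exact hne (hfirst c' hc' (hG.btw_of_btw_right h3 hb'))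
    · exact fun h => absurd hc h

theorem avoidWeight_eq_zero_of_not_below {D : Finset V} {t i : V} (h : ¬ T.Below hG t i) :
    T.avoidWeight hG D t i = 0 := by
  rw [avoidWeight, dirWeight_eq_zero h]
  simp

/-- If `(CA, CB)` separates the treks from `r` to `s`, then the covariance factors through
`CA ∪ CB`. -/
theorem trekPolynomial_eq_sum_add_sum {CA CB : Finset V} {r s : V}
    (h : ∀ t, T.Below hG t r → T.Below hG t s →
      (∃ c ∈ CA, hG.Btw c t r) ∨ ∃ c ∈ CB, hG.Btw c t s) :
    T.trekPolynomial r s =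
      ∑ c ∈ CA, T.dirWeight hG c r *
        ∑ t, T.errorVariance hG t * T.hitWeight hG CA t c * T.dirWeight hG t s +
      ∑ c ∈ CB, (∑ t, T.errorVariance hG t * T.avoidWeight hG CA t r * T.hitWeight hG CB t c) *
        T.dirWeight hG c s := by
  classical
  -- By separation, no pair of directed paths avoids both sets. Hence only pairs whose first path
  -- meets `CA`, or avoids it while the second meets `CB`, contribute.
  have h0 : ∀ t, T.avoidWeight hG CA t r * T.avoidWeight hG CB t s = 0 := by
    intro t
    by_cases hr : T.Below hG t r
    swap
    · rw [avoidWeight_eq_zero_of_not_below hr, zero_mul]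
    by_cases hs : T.Below hG t s
    swap
    · rw [avoidWeight_eq_zero_of_not_below hs, mul_zero]
    rcases h t hr hs with ⟨c, hc, hb⟩ | ⟨c, hc, hb⟩
    · rw [avoidWeight, if_neg (fun h' => h' c hc hb), zero_mul]
    · have : T.avoidWeight hG CB t s = 0 := if_neg fun h' => h' c hc hb
      rw [this, mul_zero]
  have key : ∀ t, T.errorVariance hG t * T.dirWeight hG t r * T.dirWeight hG t s =
      ∑ c ∈ CA, T.dirWeight hG c r *
        (T.errorVariance hG t * T.hitWeight hG CA t c * T.dirWeight hG t s) +
      ∑ c ∈ CB, (T.errorVariance hG t * T.avoidWeight hG CA t r * T.hitWeight hG CB t c) *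
        T.dirWeight hG c s := by
    intro t
    have e1 : ∑ c ∈ CA, T.dirWeight hG c r *
        (T.errorVariance hG t * T.hitWeight hG CA t c * T.dirWeight hG t s) =
        T.errorVariance hG t * T.dirWeight hG t s *
          ∑ c ∈ CA, T.hitWeight hG CA t c * T.dirWeight hG c r := by
      rw [Finset.mul_sum]
      exact Finset.sum_congr rfl fun _ _ => by ring
    have e2 : ∑ c ∈ CB, (T.errorVariance hG t * T.avoidWeight hG CA t r *
        T.hitWeight hG CB t c) * T.dirWeight hG c s =
        T.errorVariance hG t * T.avoidWeight hG CA t r *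
          ∑ c ∈ CB, T.hitWeight hG CB t c * T.dirWeight hG c s := by
      rw [Finset.mul_sum]
      exact Finset.sum_congr rfl fun _ _ => by ring
    rw [e1, e2]
    have e3 := dirWeight_eq_add_sum (hG := hG) CA t r
    have e4 := dirWeight_eq_add_sum (hG := hG) CB t s
    have h0t := h0 t
    generalize ∑ c ∈ CA, T.hitWeight hG CA t c * T.dirWeight hG c r = p at *
    generalize ∑ c ∈ CB, T.hitWeight hG CB t c * T.dirWeight hG c s = q at *
    rw [e3, e4]
    linear_combination (T.errorVariance hG t) * h0t
  rw [trekPolynomial_eq_sum_errorVariance hG, Finset.sum_congr rfl fun t _ => key t,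
    Finset.sum_add_distrib, Finset.sum_comm, Finset.sum_comm (t := CB)]
  simp_rw [Finset.mul_sum, Finset.sum_mul]

end DAG

/-! ### d-separation makes the covariance block factor. -/

namespace DAG

variable {V : Type*} {T : DAG V} {hG : T.skeleton.IsTree}

/-! ### Paths that are active given a set -/

variable (hG) in
/-- The vertex `u` of the path between `i` and `j` does not block this path given `C`. -/
def OpenAt (C : Finset V) (u i j : V) : Prop :=
  (T.Adj (hG.next u i) u ∧ T.Adj (hG.next u j) u → ∃ d ∈ C, Relation.ReflTransGen T.Adj u d) ∧
  (¬ (T.Adj (hG.next u i) u ∧ T.Adj (hG.next u j) u) → u ∉ C)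

variable (hG) in
/-- The inner vertices of the path between `x` and `y` do not block it given `C`, and the path
enters those of its ends that lie in `C`. -/
def Active (C : Finset V) (x y : V) : Prop :=
  (x ∈ C → T.Adj (hG.next x y) x) ∧ (y ∈ C → T.Adj (hG.next y x) y) ∧
  ∀ u, hG.Btw u x y → u ≠ x → u ≠ y → T.OpenAt hG C u x y

theorem OpenAt.symm {C : Finset V} {u x y : V} (h : T.OpenAt hG C u x y) :
    T.OpenAt hG C u y x := by
  unfold OpenAt at *
  rwa [and_comm (a := T.Adj (hG.next u y) u)]

theorem OpenAt.congr_right {C : Finset V} {u x y z : V} (h : T.OpenAt hG C u x y)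
    (e : hG.next u y = hG.next u z) : T.OpenAt hG C u x z := by
  unfold OpenAt at *
  rwa [← e]

theorem Active.symm {C : Finset V} {x y : V} (h : T.Active hG C x y) : T.Active hG C y x :=
  ⟨h.2.1, h.1, fun u hu h1 h2 => (h.2.2 u (hG.btw_comm.1 hu) h2 h1).symm⟩

/-- A vertex from which an active path goes down towards an element of `C` is an ancestor of an
element of `C`. -/
theorem Active.exists_reflTransGen {C : Finset V} {a c m : V} (h : T.Active hG C a c)
    (hc : c ∈ C) (hm : hG.Btw m a c) (hn : ¬ T.Adj (hG.next m c) m) :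
    ∃ d ∈ C, Relation.ReflTransGen T.Adj m d := by
  induction hl : (hG.path m c).length generalizing m with
  | zero =>
    have : m = c := SimpleGraph.Walk.eq_of_length_eq_zero hl
    exact ⟨c, hc, this ▸ .refl⟩
  | succ n ih =>
    have hne : m ≠ c := by
      rintro rfl
      rw [hG.path_self] at hl
      simp at hl
    rw [hG.length_path hne] at hl
    have hadj := adj_next_of_not hn hne
    have hnext := hG.next_next hne
    have hbm := hG.btw_next m c
    set w := hG.next m c with hw
    have hbw : hG.Btw w a c := hG.btw_trans_right hbm hm
    by_cases hwc : w = c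
    · exact ⟨c, hc, .single (hwc ▸ hadj)⟩
    -- The descent towards `c` stops before `c` only at a collider, which, being open, has an
    -- element of `C` at or below it.
    by_cases h1 : T.Adj (hG.next w c) w
    · have hwm : w ≠ m := by
        intro h'
        rw [h'] at hadj
        exact T.not_adj_self _ hadj
      have hbma : hG.Btw m a w := hG.btw_of_btw_right hbm hm
      have hwa : w ≠ a := by
        intro h'
        rw [← h', hG.btw_self] at hbma
        exact hwm hbma.symm
      have e : hG.next w a = m := by
        rw [hG.next_eq_of_btw (hG.btw_comm.1 hbma) hwm, hnext]
      obtain ⟨d, hd, hwd⟩ := (h.2.2 w hbw hwa hwc).1 ⟨e ▸ hadj, h1⟩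
      exact ⟨d, hd, .head hadj hwd⟩
    · obtain ⟨d, hd, hwd⟩ := ih hbw h1 (by omega)
      exact ⟨d, hd, .head hadj hwd⟩

/-- Active paths that meet in an element of `C` can be joined. -/
theorem Active.trans {C : Finset V} {a c y : V} (hac : T.Active hG C a c)
    (hyc : T.Active hG C y c) (hc : c ∈ C) (hay : a ≠ y) : T.Active hG C a y := by
  have hca : c ≠ a := next_ne_of_adj (hac.2.1 hc)
  have hcy : c ≠ y := next_ne_of_adj (hyc.2.1 hc)
  -- The joined path follows the given ones except at the median `m`, the only vertex where its two
  -- neighbours may come from different paths.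
  obtain ⟨m, hm, hma, hmy⟩ := hG.exists_median a y c
  have hmy' := hG.btw_comm.1 hm
  have entry : ∀ {a y}, T.Active hG C a c → T.Active hG C y c → a ≠ y → c ≠ a → hG.Btw m a y →
      hG.Btw m a c → hG.Btw m y c → a ∈ C → T.Adj (hG.next a y) a := by
    intro a y hac hyc hay hca hm hma hmy ha
    by_cases ham : a = m
    · subst ham
      by_contra h
      exact (hyc.2.2 a hmy hay (Ne.symm hca)).2 (fun h' => h h'.1) ha
    · rw [hG.next_eq_of_btw hm ham, ← hG.next_eq_of_btw hma ham]
      exact hac.1 ha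
  have inner : ∀ {a y}, T.Active hG C a c → hG.Btw m a y → hG.Btw m a c → ∀ u, hG.Btw u a m →
      u ≠ a → u ≠ m → T.OpenAt hG C u a y := by
    intro a y hac hm hma u hu hua hum
    have huc : u ≠ c := by
      rintro rfl
      exact hum (hG.btw_antisymm hu hma)
    refine (hac.2.2 u (hG.btw_trans_left hu hma) hua huc).congr_right ?_
    rw [hG.next_eq_of_btw (hG.btw_of_btw_left hu hma) hum,
      hG.next_eq_of_btw (hG.btw_of_btw_left hu hm) hum]
  refine ⟨entry hac hyc hay hca hm hma hmy, entry hyc hac hay.symm hcy hmy' hmy hma, ?_⟩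
  intro u hu hua huy
  by_cases hum : u = m
  · subst hum
    -- If `m = c`, both paths enter it and `c` is an open collider. Otherwise a new collider at `m`
    -- either is one on the path from `a` to `c` or descends towards `c`, and a non-collider is one
    -- on the path whose edge leaves `m`.
    by_cases huc : u = c
    · subst huc
      exact ⟨fun _ => ⟨u, hc, .refl⟩, fun h => absurd ⟨hac.2.1 hc, hyc.2.1 hc⟩ h⟩
    have h1 := hac.2.2 u hma hua huc
    have h2 := hyc.2.2 u hmy huy huc
    refine ⟨fun h => ?_, fun h => ?_⟩
    · by_cases h3 : T.Adj (hG.next u c) u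
      · exact h1.1 ⟨h.1, h3⟩
      · exact hac.exists_reflTransGen hc hma h3
    · by_cases h3 : T.Adj (hG.next u a) u
      · exact h2.2 fun h4 => h ⟨h3, h4.1⟩
      · exact h1.2 fun h4 => h3 h4.1
  · rcases hG.btw_or hu m with h | h
    · exact inner hac hm hma u h hua hum
    · exact (inner hyc hmy' hmy u (hG.btw_comm.1 h) huy hum).symm

/-- There is no active path between d-separated vertices. -/
theorem DSeparates.not_active {A B C : Finset V} (h : T.DSeparates C A B) (hAC : Disjoint A C)
    (hBC : Disjoint B C) {a b : V} (ha : a ∈ A) (hb : b ∈ B) : ¬ T.Active hG C a b := by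
  intro hact
  obtain ⟨k, hk, h1⟩ := h a ha b hb _ (hG.path_isPath a b)
  have haC := Finset.disjoint_left.1 hAC ha
  have hbC := Finset.disjoint_left.1 hBC hb
  rw [isCollider_path] at h1
  have hk' : hG.Btw k a b := hk
  rcases h1 with ⟨h1, h2⟩ | ⟨h1, h2, h3⟩
  · have hka : k ≠ a := by
      rintro rfl
      exact haC h2
    have hkb : k ≠ b := by
      rintro rfl
      exact hbC h2
    exact (hact.2.2 k hk' hka hkb).2 (fun h => h1 ⟨hk', h⟩) h2
  · obtain ⟨d, hd, hkd⟩ :=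
      (hact.2.2 k hk' (next_ne_of_adj h1.2.1) (next_ne_of_adj h1.2.2)).1 h1.2
    rcases Relation.reflTransGen_iff_eq_or_transGen.1 hkd with rfl | hkd
    · exact h2 hd
    · exact h3 d hd hkd

/-- The first vertex in `C` of a directed path, or its end. -/
theorem exists_first_or_end (C : Finset V) (t r : V) :
    ∃ x, hG.Btw x t r ∧ (∀ d ∈ C, hG.Btw d t x → d = x) ∧ (x ∈ C ∨ x = r) := by
  by_cases h : ∃ c ∈ C, hG.Btw c t r
  · obtain ⟨c, hc, hb⟩ := h
    obtain ⟨x, hx, hxb, hfirst⟩ := exists_first_btw hc hb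
    exact ⟨x, hxb, hfirst, .inl hx⟩
  · push Not at h
    exact ⟨r, hG.btw_right _ _, fun d hd hb => absurd hb (h d hd), .inr rfl⟩

/-- The directed paths from a vertex outside `C` to two vertices, with no inner vertex in `C`,
combine to an active path. -/
theorem Below.active {C : Finset V} {t x y : V} (hx : T.Below hG t x) (hy : T.Below hG t y)
    (ht : t ∉ C) (hxC : ∀ d ∈ C, hG.Btw d t x → d = x) (hyC : ∀ d ∈ C, hG.Btw d t y → d = y)
    (hne : x ≠ y) : T.Active hG C x y := by
  have entry : ∀ {x y}, T.Below hG t x → (∀ d ∈ C, hG.Btw d t y → d = y) → x ≠ y → x ∈ C →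
      T.Adj (hG.next x y) x := by
    intro x y hx hyC hne hxC
    have hnb : ¬ hG.Btw x t y := fun h => hne (hyC x hxC h)
    rw [← (hG.not_btw_iff.1 hnb).1]
    refine hx.adj_next ?_
    rintro rfl
    exact ht hxC
  refine ⟨entry hx hyC hne, entry hy hxC hne.symm, fun u hu hux huy => ?_⟩
  rcases hG.btw_or hu t with h | h
  · rw [hG.btw_comm] at h
    exact ⟨fun h' => absurd h'.1 (hx.not_adj_next h), fun _ huC => hux (hxC u huC h)⟩
  · exact ⟨fun h' => absurd h'.2 (hy.not_adj_next h), fun _ huC => huy (hyC u huC h)⟩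

/-- A d-separating set splits into two parts that separate the treks. -/
theorem DSeparates.exists_btw {A B C : Finset V} (h : T.DSeparates C A B) (hAB : Disjoint A B)
    (hAC : Disjoint A C) (hBC : Disjoint B C) : ∃ p : V → Prop, ∀ {r s t : V},
      r ∈ A ∨ r ∈ C → s ∈ B ∨ s ∈ C → T.Below hG t r → T.Below hG t s →
        (∃ c ∈ C, ¬ p c ∧ hG.Btw c t r) ∨ ∃ c ∈ C, p c ∧ hG.Btw c t s := by
  -- The elements of `C` reachable from `A` by active paths block the side of `B`, the others the
  -- side of `A`. An unblocked pair of directed paths would continue an active path from `A` to an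
  -- unreachable element of `C` or to `B`.
  refine ⟨fun c => ∃ a ∈ A, T.Active hG C a c, fun {r s t} hr hs htr hts => ?_⟩
  by_contra hcon
  rw [not_or] at hcon
  obtain ⟨hA, hB⟩ := hcon
  have hA' : ∀ c ∈ C, hG.Btw c t r → ∃ a ∈ A, T.Active hG C a c := by
    intro c hc hb
    by_contra h'
    exact hA ⟨c, hc, h', hb⟩
  have hB' : ∀ c ∈ C, hG.Btw c t s → ¬ ∃ a ∈ A, T.Active hG C a c := fun c hc hb h' =>
    hB ⟨c, hc, h', hb⟩
  have ht : t ∉ C := fun htC => hB' t htC (hG.btw_left _ _) (hA' t htC (hG.btw_left _ _))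
  obtain ⟨x, hxb, hx1, hx2⟩ := exists_first_or_end (hG := hG) C t r
  obtain ⟨y, hyb, hy1, hy2⟩ := exists_first_or_end (hG := hG) C t s
  have hx3 : x ∈ C ∨ x ∈ A := by
    rcases hx2 with hx2 | rfl
    · exact .inl hx2
    · exact hr.symm
  have hy3 : y ∈ C ∨ y ∈ B := by
    rcases hy2 with hy2 | rfl
    · exact .inl hy2
    · exact hs.symm
  have hAy : ∀ a ∈ A, a ≠ y := by
    rintro a ha rfl
    rcases hy3 with hy3 | hy3
    · exact Finset.disjoint_left.1 hAC ha hy3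
    · exact Finset.disjoint_left.1 hAB ha hy3
  have hxy : x ≠ y := by
    rcases hx3 with hx3 | hx3
    · rintro rfl
      exact hB' x hx3 hyb (hA' x hx3 hxb)
    · exact hAy x hx3
  have hact := (htr.left hxb).active (hts.left hyb) ht hx1 hy1 hxy
  have : ∃ a ∈ A, T.Active hG C a y := by
    rcases hx3 with hx3 | hx3
    · obtain ⟨a, ha, hax⟩ := hA' x hx3 hxb
      exact ⟨a, ha, hax.trans hact.symm hx3 (hAy a ha)⟩
    · exact ⟨x, hx3, hact⟩
  rcases hy3 with hy3 | hy3
  · exact hB' y hy3 hyb this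
  · obtain ⟨a, ha, hay⟩ := this
    exact h.not_active hAC hBC ha hy3 hay

/-- The determinant of a product through too few indices vanishes. -/
theorem det_eq_zero_of_factor {R ι : Type*} [CommRing R] (C : Finset ι)
    (M : Matrix (Fin (C.card + 1)) (Fin (C.card + 1)) R) (P Q : Fin (C.card + 1) → ι → R)
    (h : ∀ a b, M a b = ∑ c ∈ C, P a c * Q b c) : M.det = 0 := by
  classical
  -- The extra index `none` pads the factors to square matrices with a zero column in the left one.
  let e : Fin (C.card + 1) ≃ Option C := Fintype.equivOfCardEq (by simp)
  let P' : Matrix (Fin (C.card + 1)) (Option C) R :=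
    Matrix.of fun a o => o.elim 0 fun c => P a c
  let Q' : Matrix (Option C) (Fin (C.card + 1)) R :=
    Matrix.of fun o b => o.elim 0 fun c => Q b c
  have hM : M = P'.submatrix id e * Q'.submatrix e id := by
    rw [Matrix.submatrix_mul_equiv]
    ext a b
    rw [h, Matrix.submatrix_apply, Matrix.mul_apply, Fintype.sum_option]
    simp only [P', Q', Matrix.of_apply, Option.elim_none, Option.elim_some, mul_zero, zero_add, id]
    exact (Finset.sum_coe_sort C fun c => P a c * Q b c).symm
  rw [hM, Matrix.det_mul, Matrix.det_eq_zero_of_column_eq_zero (e.symm none), zero_mul]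
  intro a
  simp [P']

variable [Fintype V]

/-- The covariances between `A ∪ C` and `B ∪ C` factor through `C`. -/
theorem DSeparates.exists_factor (hG : T.skeleton.IsTree) {A B C : Finset V}
    (h : T.DSeparates C A B) (hAB : Disjoint A B) (hAC : Disjoint A C) (hBC : Disjoint B C) :
    ∃ P Q : V → V → T.ParamRing, ∀ r s, r ∈ A ∨ r ∈ C → s ∈ B ∨ s ∈ C →
      T.trekPolynomial r s = ∑ c ∈ C, P r c * Q s c := by
  classical
  obtain ⟨p, hp⟩ := h.exists_btw (hG := hG) hAB hAC hBC
  set CA := C.filter (fun c => ¬ p c) with hCA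
  set CB := C.filter p with hCB
  -- Each `d ∈ C` carries one product of a function of `r` and a function of `s`; `p d` decides at
  -- which of the two paths the cut at `d` is made.
  refine ⟨fun r d => if p d then
      ∑ t, T.errorVariance hG t * T.avoidWeight hG CA t r * T.hitWeight hG CB t d
      else T.dirWeight hG d r,
    fun s d => if p d then T.dirWeight hG d s
      else ∑ t, T.errorVariance hG t * T.hitWeight hG CA t d * T.dirWeight hG t s,
    fun r s hr hs => ?_⟩
  rw [trekPolynomial_eq_sum_add_sum (hG := hG) (CA := CA) (CB := CB)
    fun t htr hts => ?_, ← Finset.sum_filter_not_add_sum_filter C p]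
  swap
  · simp only [hCA, hCB, Finset.mem_filter, and_assoc]
    exact hp hr hs htr hts
  congr 1
  · refine Finset.sum_congr rfl fun d hd => ?_
    rw [Finset.mem_filter] at hd
    beta_reduce
    rw [if_neg hd.2, if_neg hd.2]
  · refine Finset.sum_congr rfl fun d hd => ?_
    rw [Finset.mem_filter] at hd
    beta_reduce
    rw [if_pos hd.2, if_pos hd.2]

/-- The conditional independence constraints hold on the model. -/
theorem ciIdeal_le_vanishingIdeal (hG : T.skeleton.IsTree) : T.ciIdeal ≤ T.vanishingIdeal := by
  unfold ciIdeal
  rw [Ideal.span_le]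
  rintro f ⟨A, B, C, hAB, hAC, hBC, h, r, c, hr, hc, rfl⟩
  obtain ⟨P, Q, hPQ⟩ := h.exists_factor hG hAB hAC hBC
  refine (RingHom.mem_ker).2 ?_
  rw [AlgHom.map_det]
  refine det_eq_zero_of_factor C _ (fun a => P (r a)) (fun b => Q (c b)) fun a b => ?_
  rw [← hPQ _ _ (hr a) (hc b), ← φ_σ]
  rfl

end DAG

end

theorem mainTheorem1 {V : Type*} [Fintype V] (T : DAG V) (hT : T.IsPolytree) :
    T.vanishingIdeal = T.ciIdeal ∧
      T.vanishingIdeal = Ideal.span (T.linearForms ∪ T.tetrads) := by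
  have h1 := DAG.vanishingIdeal_le_span hT
  have h2 := DAG.span_le_ciIdeal hT
  have h3 := DAG.ciIdeal_le_vanishingIdeal hT
  exact ⟨le_antisymm (h1.trans h2) h3, le_antisymm h1 (h2.trans h3)⟩
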